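/- All graphs are finite and simple. A \emph{hexagon} of a graph is a cycle of length 6 in it. A \emph{benzenoid graph} is a 2-connected plane graph in which all inner faces are hexagons and all hexagons are inner faces, such that any two distinct hexagons are either disjoint or meet in exactly one common edge, and no three hexagons share a common edge. It is \emph{catacondensed} if no vertex is shared by three hexagons. Two distinct hexagons are \emph{adjacent} if they have a common edge. A hexagon is \emph{linear} if it is adjacent to exactly two other hexagons and its two vertices of degree 2 are not adjacent to each other. For a perfect matching $M$, a hexagon is \emph{$M$-alternating} if $M$ contains exactly three of its edges. The \emph{Clar number} ${\rm Cl}(B)$ is the maximum cardinality of a set of pairwise disjoint $M$-alternating hexagons, taken over all perfect matchings $M$ of $B$. \textbf{Lemma.} Let $B$ be a catacondensed benzenoid graph, $h_0$ a hexagon of $B$ that is adjacent to at most one other hexagon of $B$, and $k\ge 1$. Let $B'$ be a benzenoid graph obtained from $B$ by adding $k$ linearly connected hexagons $h_1,\dots,h_k$ to $h_0$ such that $h_0$ is also linearly connected or adjacent only to $h_1$. That is: $B'$ contains (a copy of) $B$ as a subgraph; $h_1,\dots,h_k$ are distinct hexagons of $B'$ that are not hexagons of $B$; $B'=B\cup h_1\cup\dots\cup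 h_k$; for $1\le i<k$ the hexagon $h_i$ is adjacent in $B'$ exactly to $h_{i-1}$ and $h_{i+1}$ and is linear in $B'$; $h_k$ is adjacent in $B'$ only to $h_{k-1}$; and in $B'$ the hexagon $h_0$ is either linear or adjacent only to $h_1$. Then $${\rm Cl}(B')={\rm Cl}(B).$$ -/

import Mathlib

namespace Benzenoid

open SimpleGraph

universe u v

/-- A (cellular) embedding of a connected graph `G` in the plane, given combinatorially by a
rotation system of genus zero: `rot` lists the darts leaving each vertex in cyclic order, the faces
are the orbits of the face-tracing permutation, and Euler's formula `|V| + |F| = |E| + 2` holds.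
(`G` is connected wherever this is used.) -/
structure PlaneEmbedding {V : Type u} (G : SimpleGraph V) where
  /-- The next dart at the same vertex. -/
  rot : Equiv.Perm G.Dart
  rot_fst : ∀ d, (rot d).fst = d.fst
  rot_sameCycle : ∀ d d' : G.Dart, d.fst = d'.fst → rot.SameCycle d d'
  euler : Nat.card V +
      Nat.card (Quotient (Equiv.Perm.SameCycle.setoid
        ((Function.Involutive.toPerm Dart.symm Dart.symm_involutive).trans rot)))
    = Nat.card G.edgeSet + 2

namespace PlaneEmbedding

variable {V : Type u} {G : SimpleGraph V}

/-- Face tracing: traverse `d`, then leave its end along the next dart in the rotation. -/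
def facePerm (P : PlaneEmbedding G) : Equiv.Perm G.Dart :=
  (Function.Involutive.toPerm Dart.symm Dart.symm_involutive).trans P.rot

/-- The faces are the orbits of face tracing. -/
def Face (P : PlaneEmbedding G) : Type u :=
  Quotient (Equiv.Perm.SameCycle.setoid P.facePerm)

/-- The face on whose boundary walk the dart `d` lies. -/
def faceOf (P : PlaneEmbedding G) (d : G.Dart) : P.Face :=
  Quotient.mk (Equiv.Perm.SameCycle.setoid P.facePerm) d

/-- The boundary of a face, as a subgraph: all vertices and edges on its boundary walk. -/
def boundary (P : PlaneEmbedding G) (f : P.Face) : G.Subgraph where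
  verts := {x | ∃ d : G.Dart, P.faceOf d = f ∧ x ∈ d.edge}
  Adj x y := ∃ d : G.Dart, P.faceOf d = f ∧ d.edge = s(x, y)
  adj_sub := by
    rintro x y ⟨d, -, hd⟩
    have h := d.edge_mem
    rwa [hd, SimpleGraph.mem_edgeSet] at h
  edge_vert := by
    rintro x y ⟨d, hf, hd⟩
    exact ⟨d, hf, by rw [hd]; exact Sym2.mem_mk_left x y⟩
  symm := ⟨by
    rintro x y ⟨d, hf, hd⟩
    exact ⟨d, hf, by rw [hd, Sym2.eq_swap]⟩⟩

end PlaneEmbedding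

variable {V : Type u}

/-- `G` is 2-connected: at least three vertices, connected, and without cut vertices. -/
def IsTwoConnected (G : SimpleGraph V) : Prop :=
  3 ≤ Nat.card V ∧ G.Connected ∧ ∀ x : V, (G.induce ({x}ᶜ : Set V)).Connected

/-- A hexagon of `G` is a cycle of length six in `G`, as a subgraph. -/
def IsHexagon {G : SimpleGraph V} (h : G.Subgraph) : Prop :=
  Nonempty (cycleGraph 6 ≃g h.coe)

/-- A benzenoid graph: a 2-connected plane graph in which all inner faces are hexagons and all
hexagons are (inner) faces, such that two distinct hexagons are disjoint or meet in exactly one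
common edge (with its two end-vertices), and no three hexagons share a common edge. -/
def IsBenzenoid (G : SimpleGraph V) : Prop :=
  IsTwoConnected G ∧
  (∃ (P : PlaneEmbedding G) (outer : P.Face),
    (∀ f : P.Face, f ≠ outer → IsHexagon (P.boundary f)) ∧
    (∀ h : G.Subgraph, IsHexagon h → ∃ f : P.Face, f ≠ outer ∧ P.boundary f = h)) ∧
  (∀ h g : G.Subgraph, IsHexagon h → IsHexagon g → h ≠ g →
    Disjoint h.verts g.verts ∨
      ∃ x y : V, h.Adj x y ∧ g.Adj x y ∧ h.verts ∩ g.verts = {x, y}) ∧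
  (∀ h₁ h₂ h₃ : G.Subgraph, IsHexagon h₁ → IsHexagon h₂ → IsHexagon h₃ →
    h₁ ≠ h₂ → h₁ ≠ h₃ → h₂ ≠ h₃ → h₁.edgeSet ∩ h₂.edgeSet ∩ h₃.edgeSet = ∅)

/-- A vertex shared by three hexagons. -/
def IsInternalVertex (G : SimpleGraph V) (x : V) : Prop :=
  ∃ h₁ h₂ h₃ : G.Subgraph, IsHexagon h₁ ∧ IsHexagon h₂ ∧ IsHexagon h₃ ∧
    h₁ ≠ h₂ ∧ h₁ ≠ h₃ ∧ h₂ ≠ h₃ ∧ x ∈ h₁.verts ∧ x ∈ h₂.verts ∧ x ∈ h₃.verts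

/-- A catacondensed benzenoid graph: one without internal vertices. -/
def IsCatacondensed (G : SimpleGraph V) : Prop :=
  IsBenzenoid G ∧ ∀ x : V, ¬ IsInternalVertex G x

/-- `h` and `g` are distinct hexagons with a common edge. -/
def HexAdj {G : SimpleGraph V} (h g : G.Subgraph) : Prop :=
  IsHexagon h ∧ IsHexagon g ∧ h ≠ g ∧ (h.edgeSet ∩ g.edgeSet).Nonempty

/-- The hexagon `h` is linear: it is adjacent to exactly two other hexagons, and its two vertices
of degree 2 (in the whole graph) are not adjacent. -/
def IsLinear {G : SimpleGraph V} (h : G.Subgraph) : Prop :=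
  IsHexagon h ∧ {g : G.Subgraph | HexAdj h g}.ncard = 2 ∧
    ∃ x y : V, x ≠ y ∧ {z ∈ h.verts | (G.neighborSet z).ncard = 2} = {x, y} ∧ ¬ G.Adj x y

/-- The hexagon `h` is `M`-alternating: `M` contains exactly three edges of `h`. -/
def IsAlternatingHexagon {G : SimpleGraph V} (M h : G.Subgraph) : Prop :=
  IsHexagon h ∧ (h.edgeSet ∩ M.edgeSet).ncard = 3

/-- The Clar number: the largest size of a set of pairwise disjoint `M`-alternating hexagons, over
all perfect matchings `M`. -/
noncomputable def clarNumber (G : SimpleGraph V) : ℕ :=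
  sSup {n : ℕ | ∃ M : G.Subgraph, M.IsPerfectMatching ∧
    ∃ C : Finset G.Subgraph, (∀ h ∈ C, IsAlternatingHexagon M h) ∧
      (C : Set G.Subgraph).Pairwise (fun h g => Disjoint h.verts g.verts) ∧ C.card = n}

/-- `B'`, containing a copy of `B` via `φ`, arises from `B` by adding `k` linearly connected
hexagons `h 1, …, h k` to the hexagon `h₀ = h 0` in such a way that `h₀` is linear in `B'` or
adjacent only to `h 1`. The chain `h 1, …, h k` hangs at `h 0`: for `1 ≤ i ≤ k` the hexagon `h i`
is adjacent to its neighbours in the chain `h 0, …, h k` and to no other hexagon. -/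
def IsLinearExtension {V' : Type v} {B : SimpleGraph V} {B' : SimpleGraph V'}
    (φ : B →g B') (h₀ : B.Subgraph) (k : ℕ) : Prop :=
  Function.Injective φ ∧
  ∃ h : ℕ → B'.Subgraph,
    h 0 = h₀.map φ ∧
    (∀ i ≤ k, IsHexagon (h i)) ∧
    Set.InjOn h (Set.Iic k) ∧
    -- the hexagons `h 1, …, h k` are new
    (∀ i, 1 ≤ i → i ≤ k → ∀ g : B.Subgraph, IsHexagon g → h i ≠ g.map φ) ∧
    -- `B'` is the union of (the copy of) `B` and of `h 1, …, h k`
    ((⊤ : B.Subgraph).map φ ⊔ ⨆ i ∈ Set.Icc 1 k, h i) = ⊤ ∧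
    -- the chain
    (∀ i, 1 ≤ i → i ≤ k → ∀ g : B'.Subgraph,
      HexAdj (h i) g ↔ g = h (i - 1) ∨ (i < k ∧ g = h (i + 1))) ∧
    (∀ i, 1 ≤ i → i < k → IsLinear (h i)) ∧
    (IsLinear (h 0) ∨ ∀ g : B'.Subgraph, HexAdj (h 0) g ↔ g = h 1)

end Benzenoid

namespace Benzenoid

open SimpleGraph

universe u v

/-! ### Faces of a 2-connected plane graph: no edge has the same face on both sides. -/

namespace PlaneEmbedding

variable {V : Type u} {G : SimpleGraph V}

/-! The hexagons are attached one at a time, so the core case is a hexagon `H' = a₁ x₁ a₂ b₂ y₁ b₁`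
glued to `H = a₀ x₀ a₁ b₁ y₀ b₀` along `a₁ b₁`, where `x₀` and `y₀` have no neighbours off `H`. A
matching of the smaller graph extends by `x₁ a₂` and `b₂ y₁`.

Conversely, take a matching of the larger graph and disjoint alternating hexagons `C`. Whenever `a₁`
and `b₁` are matched inside `H'`, the edges `x₀ a₀` and `y₀ b₀` are forced, so rematching `a₁` with
`b₁` makes `H` alternating (`exists_reroute`). If `H' ∈ C`, exchange it for `H`: the other members
avoid `a₁, b₁`, hence `x₀, y₀`, hence their partners `a₀, b₀`. If `H' ∉ C`, either the matching
restricts, or `a₂ b₂` is matched and the same rerouting leaves `C` intact. Thus all attainable sizes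
agree, not only the maxima (`clarSet_eq`).

To reach this picture one needs that every edge of a benzenoid graph lies in a hexagon
(`exists_hexagon_adj`). It follows once the two sides of an edge are distinct faces, which is
obtained from Euler's formula by a dimension count. It then gives that linearity leaves `x₀, y₀`
without outside edges (`adj_of_adj`), and that the copy of `B` is an induced subgraph
(`adj_of_map_adj`). -/

theorem faceOf_facePerm (P : PlaneEmbedding G) (d : G.Dart) :
    P.faceOf (P.facePerm d) = P.faceOf d :=
  Quotient.sound (Equiv.Perm.sameCycle_apply_left.2 (Equiv.Perm.SameCycle.refl _ _))

theorem faceOf_rot (P : PlaneEmbedding G) (d : G.Dart) :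
    P.faceOf (P.rot d) = P.faceOf d.symm := by
  have h := P.faceOf_facePerm d.symm
  have e : P.facePerm d.symm = P.rot d := by
    simp [facePerm, Function.Involutive.toPerm]
  rwa [e] at h

/-- A function on faces that does not change across any edge of a connected plane graph takes the
same value on the faces of all darts. -/
theorem const_of_symm_invariant [Finite V] (P : PlaneEmbedding G) (hG : G.Connected)
    {α : Type*} (c : P.Face → α) (hc : ∀ d, c (P.faceOf d) = c (P.faceOf d.symm))
    (d d' : G.Dart) : c (P.faceOf d) = c (P.faceOf d') := by
  classical
  have hrot : ∀ d, c (P.faceOf (P.rot d)) = c (P.faceOf d) := fun d => by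
    rw [faceOf_rot, ← hc]
  have hcyc : ∀ d d' : G.Dart, d.fst = d'.fst → c (P.faceOf d) = c (P.faceOf d') := by
    intro d d' h
    have := Fintype.ofFinite V
    obtain ⟨n, hn⟩ := (P.rot_sameCycle d d' h).exists_nat_pow_eq
    rw [← hn]
    clear hn
    induction n with
    | zero => simp
    | succ n ih => rw [pow_succ', Equiv.Perm.mul_apply, hrot, ih]
  have key : ∀ u v : V, G.Walk u v → ∀ d d' : G.Dart, d.fst = u → d'.fst = v →
      c (P.faceOf d) = c (P.faceOf d') := by
    intro u v p
    induction p with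
    | nil => intro d d' h h'; exact hcyc d d' (h.trans h'.symm)
    | @cons u w v huw p ih =>
      intro d d' h h'
      rw [hcyc d ⟨(u, w), huw⟩ h, hc]
      exact ih _ _ rfl h'
  obtain ⟨p⟩ := hG.preconnected d.fst d'.fst
  exact key _ _ p d d' rfl rfl

/-- A sum over the edges, each with a chosen orientation, is half the sum over the darts. -/
theorem sum_dart_eq_two_mul_sum_edge {W : Type*} {H : SimpleGraph W} [Fintype H.Dart]
    [Fintype H.edgeSet] (o : H.edgeSet → H.Dart)
    (ho : ∀ e, (o e).edge = e) (F : H.Dart → ℚ) (hF : ∀ d, F d.symm = F d) :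
    ∑ d, F d = 2 * ∑ e, F (o e) := by
  classical
  rw [Finset.mul_sum, ← Finset.sum_fiberwise Finset.univ
    (fun d : H.Dart => (⟨d.edge, d.edge_mem⟩ : H.edgeSet)) F]
  refine Finset.sum_congr rfl fun e _ => ?_
  have : (Finset.univ.filter fun d : H.Dart => (⟨d.edge, d.edge_mem⟩ : H.edgeSet) = e)
      = {o e, (o e).symm} := by
    ext d
    simp only [Finset.mem_filter, Finset.mem_univ, true_and, Finset.mem_insert,
      Finset.mem_singleton, Subtype.ext_iff]
    rw [← ho e, dart_edge_eq_iff]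
  rw [this, Finset.sum_pair (Dart.symm_ne _).symm, hF]
  ring

/-- The coboundary of a function on the faces is orthogonal to that of a function on the
vertices. -/
theorem sum_face_mul_vertex_eq_zero [Fintype G.Dart] [Fintype G.edgeSet] (P : PlaneEmbedding G)
    (o : G.edgeSet → G.Dart) (ho : ∀ e, (o e).edge = e) (c : P.Face → ℚ) (g : V → ℚ) :
    ∑ e, (c (P.faceOf (o e)) - c (P.faceOf (o e).symm)) * (g (o e).fst - g (o e).snd) = 0 := by
  have h2 := sum_dart_eq_two_mul_sum_edge o ho
    (fun d => (c (P.faceOf d) - c (P.faceOf d.symm)) * (g d.fst - g d.snd))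
    (fun d => by simp only [Dart.symm_symm]; change _ * (g d.snd - g d.fst) = _; ring)
  have hs : ∀ F : G.Dart → ℚ, ∑ d : G.Dart, F d.symm = ∑ d, F d := fun F =>
    Equiv.sum_comp (Function.Involutive.toPerm Dart.symm Dart.symm_involutive) F
  have h3 : ∑ d : G.Dart, (c (P.faceOf d) - c (P.faceOf d.symm)) * (g d.fst - g d.snd) = 0 := by
    have e1 := hs (fun d => c (P.faceOf d) * g d.fst)
    have e2 := hs (fun d => c (P.faceOf d) * g d.snd)
    -- Reindexing by `P.rot` keeps the tail and turns the face of `d` into that of `d.symm`.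
    -- Together with `e2'` this equates the two sums whose difference, doubled, is the total.
    have e3 : ∑ d : G.Dart, c (P.faceOf d.symm) * g d.fst = ∑ d, c (P.faceOf d) * g d.fst := by
      rw [← Equiv.sum_comp P.rot (fun d => c (P.faceOf d) * g d.fst)]
      exact Finset.sum_congr rfl fun d _ => by rw [faceOf_rot, P.rot_fst]
    have e1' : ∑ d : G.Dart, c (P.faceOf d.symm) * g d.snd = ∑ d, c (P.faceOf d) * g d.fst := e1
    have e2' : ∑ d : G.Dart, c (P.faceOf d.symm) * g d.fst = ∑ d, c (P.faceOf d) * g d.snd := e2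
    simp only [sub_mul, mul_sub, Finset.sum_sub_distrib]
    linarith
  linarith

/-- The two sides of an edge of a 2-connected plane graph are distinct faces. -/
theorem faceOf_ne_faceOf_symm [Finite V] (P : PlaneEmbedding G) (hG : IsTwoConnected G)
    (d₀ : G.Dart) : P.faceOf d₀ ≠ P.faceOf d₀.symm := by
  classical
  intro hd
  have := Fintype.ofFinite V
  have : Finite P.Face := Quotient.finite _
  have := Fintype.ofFinite P.Face
  have := Fintype.ofFinite G.edgeSet
  have hex : ∀ e : G.edgeSet, ∃ d : G.Dart, d.edge = e := by
    rintro ⟨e, he⟩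
    induction e with
    | _ x y => exact ⟨⟨(x, y), he⟩, rfl⟩
  choose o ho using hex
  let e₀ : G.edgeSet := ⟨d₀.edge, d₀.edge_mem⟩
  have he₀ : P.faceOf (o e₀) = P.faceOf (o e₀).symm := by
    rcases (dart_edge_eq_iff _ _).1 (ho e₀) with h | h
    · rw [h, hd]
    · rw [h, Dart.symm_symm, hd]
  -- Sum of the face and vertex coboundaries, with the vertex part deleted at `e₀`. The two extra
  -- coordinates kill the constants. Since both sides of `e₀` are the same face, the `e₀` coordinate
  -- vanishes identically, so `L` is not surjective; the contradiction is that it is injective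
  -- between spaces of equal dimension.
  let L : ((P.Face → ℚ) × (V → ℚ)) →ₗ[ℚ] ((G.edgeSet → ℚ) × ℚ × ℚ) :=
    { toFun := fun p => (fun e => (p.1 (P.faceOf (o e)) - p.1 (P.faceOf (o e).symm)) +
          (if e = e₀ then 0 else p.2 (o e).fst - p.2 (o e).snd),
          p.1 (P.faceOf d₀), p.2 d₀.fst)
      map_add' := by
        intro p q
        refine Prod.ext (funext fun e => ?_) (Prod.ext ?_ ?_) <;> simp
        split_ifs <;> ring
      map_smul' := by
        intro r p
        refine Prod.ext (funext fun e => ?_) (Prod.ext ?_ ?_) <;> simp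
        split_ifs <;> ring }
  have hinj : Function.Injective L := by
    rw [← LinearMap.ker_eq_bot, LinearMap.ker_eq_bot']
    rintro ⟨c, g⟩ h
    have h1 : ∀ e, (c (P.faceOf (o e)) - c (P.faceOf (o e).symm)) +
          (if e = e₀ then 0 else g (o e).fst - g (o e).snd) = 0 := fun e =>
      congrFun (congrArg Prod.fst h) e
    have hc0 : c (P.faceOf d₀) = 0 := congrArg (fun z => z.2.1) h
    have hg0 : g d₀.fst = 0 := congrArg (fun z => z.2.2) h
    have horth := P.sum_face_mul_vertex_eq_zero o ho c g
    -- Off `e₀` the two coboundaries are opposite, and at `e₀` the face part is zero, so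
    -- orthogonality becomes a vanishing sum of squares.
    have hsq : ∑ e, (c (P.faceOf (o e)) - c (P.faceOf (o e).symm)) ^ 2 = 0 := by
      rw [← neg_eq_zero, ← Finset.sum_neg_distrib, ← horth]
      refine Finset.sum_congr rfl fun e _ => ?_
      by_cases he : e = e₀
      · subst he; rw [he₀]; ring
      · have := h1 e
        rw [if_neg he] at this
        have h' : g (o e).fst - g (o e).snd =
          -(c (P.faceOf (o e)) - c (P.faceOf (o e).symm)) := by linarith
        rw [h']; ring
    have hA : ∀ e, c (P.faceOf (o e)) - c (P.faceOf (o e).symm) = 0 := fun e => by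
      have := (Finset.sum_eq_zero_iff_of_nonneg (fun _ _ => sq_nonneg _)).1 hsq e
        (Finset.mem_univ _)
      exact pow_eq_zero_iff (two_ne_zero) |>.1 this
    have hcs : ∀ d, c (P.faceOf d) = c (P.faceOf d.symm) := by
      intro d
      have h := hA ⟨d.edge, d.edge_mem⟩
      rcases (dart_edge_eq_iff _ _).1 (ho ⟨d.edge, d.edge_mem⟩) with h' | h'
      · rw [h'] at h; linarith
      · rw [h', Dart.symm_symm] at h; linarith
    have hc : c = 0 := by
      funext f
      obtain ⟨d, rfl⟩ : ∃ d, P.faceOf d = f := Quotient.exists_rep f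
      rw [P.const_of_symm_invariant hG.2.1 c hcs d d₀, hc0]; rfl
    have hg1 : ∀ x y, G.Adj x y → s(x, y) ≠ d₀.edge → g x = g y := by
      intro x y hxy hne
      have h := h1 ⟨s(x, y), hxy⟩
      rw [hA, if_neg (fun h => hne (congrArg Subtype.val h))] at h
      rcases (dart_edge_eq_iff (o ⟨s(x, y), hxy⟩) ⟨(x, y), hxy⟩).1 (ho ⟨s(x, y), hxy⟩) with h' | h'
      · rw [h'] at h; simp at h; linarith
      · rw [h'] at h; simp at h; linarith
    -- Deleting an end of `e₀` also removes `e₀` and leaves the graph connected, so `g` is constant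
    -- on the rest. A third vertex links the statements for the two ends.
    have hg2 : ∀ z, z ∈ d₀.edge → ∀ x y, x ≠ z → y ≠ z → g x = g y := by
      intro z hz x y hx hy
      have hcon := (hG.2.2 z).preconnected ⟨x, hx⟩ ⟨y, hy⟩
      have : ∀ a b : ({z}ᶜ : Set V), (G.induce ({z}ᶜ : Set V)).Walk a b → g a = g b := by
        intro a b p
        induction p with
        | nil => rfl
        | @cons a b _ hab p ih =>
          rw [← ih]
          refine hg1 _ _ hab fun h => ?_
          rw [← h] at hz
          rcases Sym2.mem_iff.1 hz with h | h
          · exact a.2 h.symm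
          · exact b.2 h.symm
      obtain ⟨p⟩ := hcon
      exact this _ _ p
    have hne := d₀.adj.ne
    obtain ⟨w, hw1, hw2⟩ : ∃ w, w ≠ d₀.fst ∧ w ≠ d₀.snd := by
      by_contra! hcon
      have hsub : (Finset.univ : Finset V) ⊆ {d₀.fst, d₀.snd} := by
        intro w _
        by_cases h : w = d₀.fst
        · simp [h]
        · simp [hcon w h]
      have := Finset.card_le_card hsub
      have h3 := hG.1
      rw [Nat.card_eq_fintype_card] at h3
      rw [Finset.card_univ] at this
      have := Finset.card_le_two (a := d₀.fst) (b := d₀.snd)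
      omega
    have hw : g w = 0 := by
      rw [← hg0]
      exact hg2 d₀.snd (Sym2.mem_mk_right _ _) _ _ hw2 hne
    have hg : g = 0 := by
      funext x
      by_cases hx : x = d₀.fst
      · rw [hx, hg0]; rfl
      · rw [hg2 d₀.fst (Sym2.mem_mk_left _ _) x w hx hw1, hw]; rfl
    rw [hc, hg]; rfl
  -- This equality is exactly Euler's formula.
  have hdim : Module.finrank ℚ ((P.Face → ℚ) × (V → ℚ)) =
      Module.finrank ℚ ((G.edgeSet → ℚ) × ℚ × ℚ) := by
    have he := P.euler
    change Nat.card V + Nat.card P.Face = _ at he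
    simp only [Module.finrank_prod, Module.finrank_fintype_fun_eq_card, Module.finrank_self]
    simp only [Nat.card_eq_fintype_card] at he
    omega
  obtain ⟨p, hp⟩ := (LinearMap.injective_iff_surjective_of_finrank_eq_finrank hdim).1 hinj
    (fun _ => 1, 0, 0)
  have := congrFun (congrArg Prod.fst hp) e₀
  simp [L, he₀] at this

end PlaneEmbedding

/-- Every edge of a benzenoid graph lies in a hexagon. -/
theorem IsBenzenoid.exists_hexagon_adj {V : Type u} [Finite V] {G : SimpleGraph V}
    (hG : IsBenzenoid G) {x y : V} (hxy : G.Adj x y) :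
    ∃ h : G.Subgraph, IsHexagon h ∧ h.Adj x y := by
  obtain ⟨h2, ⟨P, outer, hin, -⟩, -⟩ := hG
  let d : G.Dart := ⟨(x, y), hxy⟩
  by_cases hd : P.faceOf d = outer
  · have hd' : P.faceOf d.symm ≠ outer := fun h =>
      P.faceOf_ne_faceOf_symm h2 d (hd.trans h.symm)
    exact ⟨_, hin _ hd', d.symm, rfl, d.edge_symm⟩
  · exact ⟨_, hin _ hd, d, rfl, rfl⟩

/-! ### Hexagons, matchings as partner functions, and Clar sets relative to a vertex set. -/

section Hexagons

variable {V : Type u} {G : SimpleGraph V}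

/-- A cyclic labelling of a hexagon. -/
theorem IsHexagon.exists_labelling {h : G.Subgraph} (hh : IsHexagon h) {x y : V}
    (hxy : h.Adj x y) :
    ∃ c : Fin 6 → V, Function.Injective c ∧ Set.range c = h.verts ∧
      (∀ i j, h.Adj (c i) (c j) ↔ j = i + 1 ∨ i = j + 1) ∧ c 0 = x ∧ c 1 = y := by
  obtain ⟨f⟩ := hh
  have hadj : ∀ i j : Fin 6, h.Adj (f i) (f j) ↔ j = i + 1 ∨ i = j + 1 := by
    intro i j
    have h1 : h.Adj (f i) (f j) ↔ (cycleGraph 6).Adj i j := f.map_adj_iff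
    rw [h1]
    clear h1
    revert i j
    decide
  have hrange : ∀ z ∈ h.verts, ∃ i, (f i : V) = z := fun z hz =>
    ⟨f.symm ⟨z, hz⟩, by simp⟩
  have hinj : Function.Injective fun i => (f i : V) :=
    Subtype.val_injective.comp f.injective
  obtain ⟨i, rfl⟩ := hrange x (h.edge_vert hxy)
  obtain ⟨j, rfl⟩ := hrange y (h.edge_vert hxy.symm)
  -- Here `s` is a symmetry of the 6-cycle: a rotation or a reflection, according to the direction
  -- of the given edge.
  have aux : ∀ s : Fin 6 → Fin 6, Function.Bijective s →
      (∀ a b, (s b = s a + 1 ∨ s a = s b + 1) ↔ (b = a + 1 ∨ a = b + 1)) →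
      s 0 = i → s 1 = j →
      ∃ c : Fin 6 → V, Function.Injective c ∧ Set.range c = h.verts ∧
      (∀ i j, h.Adj (c i) (c j) ↔ j = i + 1 ∨ i = j + 1) ∧ c 0 = f i ∧ c 1 = f j := by
    intro s hs hs' h0 h1
    refine ⟨fun a => f (s a), hinj.comp hs.1, ?_, ?_, by simp [h0], by simp [h1]⟩
    · ext z
      constructor
      · rintro ⟨a, rfl⟩; exact (f (s a)).2
      · intro hz
        obtain ⟨b, rfl⟩ := hrange z hz
        obtain ⟨a, rfl⟩ := hs.2 b
        exact ⟨a, rfl⟩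
    · intro a b
      rw [hadj, hs']
  have hb1 : ∀ i : Fin 6, Function.Bijective fun a => a + i := by decide
  have hb2 : ∀ i : Fin 6, Function.Bijective fun a => i - a := by decide
  rcases (hadj i j).1 hxy with hj | hi
  · refine aux (fun a => a + i) (hb1 i) (by intro a b; grind) (by simp)
      (by rw [hj, add_comm])
  · refine aux (fun a => i - a) (hb2 i) (by intro a b; grind) (by simp)
      (by rw [hi]; simp)

theorem IsHexagon.exists_adj {h : G.Subgraph} (hh : IsHexagon h) : ∃ x y, h.Adj x y := by
  obtain ⟨f⟩ := hh
  exact ⟨f 0, f 1, f.map_adj_iff.2 (by decide)⟩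

theorem IsHexagon.verts_ncard {h : G.Subgraph} (hh : IsHexagon h) : h.verts.ncard = 6 := by
  obtain ⟨x, y, hxy⟩ := hh.exists_adj
  obtain ⟨c, hc, hr, -⟩ := hh.exists_labelling hxy
  rw [← hr, ← Set.image_univ, Set.ncard_image_of_injective _ hc]
  simp

/-- Each vertex of a hexagon has exactly two neighbours in it. -/
theorem IsHexagon.neighborSet_ncard {h : G.Subgraph} (hh : IsHexagon h) {v : V}
    (hv : v ∈ h.verts) : (h.neighborSet v).ncard = 2 := by
  obtain ⟨x, y, hxy⟩ := hh.exists_adj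
  obtain ⟨c, hc, hr, hadj, -⟩ := hh.exists_labelling hxy
  rw [← hr] at hv
  obtain ⟨i, rfl⟩ := hv
  have : h.neighborSet (c i) = {c (i + 1), c (i - 1)} := by
    ext z
    simp only [Subgraph.mem_neighborSet, Set.mem_insert_iff, Set.mem_singleton_iff]
    constructor
    · intro hz
      have hz' : z ∈ Set.range c := by rw [hr]; exact h.edge_vert hz.symm
      obtain ⟨j, rfl⟩ := hz'
      rcases (hadj i j).1 hz with rfl | rfl
      · exact Or.inl rfl
      · right; simp
    · rintro (rfl | rfl)
      · exact (hadj _ _).2 (Or.inl rfl)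
      · exact (hadj _ _).2 (Or.inr (by simp))
  rw [this, Set.ncard_pair]
  have hne : ∀ i : Fin 6, i + 1 ≠ i - 1 := by decide
  exact fun h => hne i (hc h)

/-- If the neighbours of a vertex `v` of a hexagon are among `a` and `b`, both are neighbours. -/
theorem IsHexagon.adj_of_forall {h : G.Subgraph} (hh : IsHexagon h) {v a b : V}
    (hv : v ∈ h.verts) (hab : ∀ z, h.Adj v z → z = a ∨ z = b) : h.Adj v a ∧ h.Adj v b := by
  have hsub : h.neighborSet v ⊆ {a, b} := fun z hz => hab z hz
  have heq : h.neighborSet v = {a, b} := by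
    refine Set.eq_of_subset_of_ncard_le hsub ?_ (by simp)
    rw [hh.neighborSet_ncard hv]
    exact (Set.ncard_insert_le _ _).trans (by simp)
  constructor
  · change a ∈ h.neighborSet v; rw [heq]; simp
  · change b ∈ h.neighborSet v; rw [heq]; simp

/-- Both have six vertices, and degree 2 at each of them, so neither vertices nor edges can be
missing. -/
theorem IsHexagon.le_antisymm {h g : G.Subgraph} (hh : IsHexagon h) (hg : IsHexagon g)
    (hle : h ≤ g) : h = g := by
  have hv : h.verts = g.verts := by
    refine Set.eq_of_subset_of_ncard_le hle.1 ?_ (Set.finite_of_ncard_ne_zero ?_)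
    · rw [hh.verts_ncard, hg.verts_ncard]
    · rw [hg.verts_ncard]; decide
  refine Subgraph.ext hv ?_
  funext x y
  refine propext ⟨fun h' => hle.2 h', fun h' => ?_⟩
  have hx : x ∈ h.verts := hv ▸ g.edge_vert h'
  have : h.neighborSet x = g.neighborSet x := by
    refine Set.eq_of_subset_of_ncard_le (fun z hz => hle.2 hz) ?_ (Set.finite_of_ncard_ne_zero ?_)
    · rw [hh.neighborSet_ncard hx, hg.neighborSet_ncard (hv ▸ hx)]
    · rw [hg.neighborSet_ncard (hv ▸ hx)]; decide
  change y ∈ h.neighborSet x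
  rw [this]; exact h'

theorem subgraph_map_injective {V' : Type v} {G' : SimpleGraph V'} {φ : G →g G'}
    (hφ : Function.Injective φ) : Function.Injective (Subgraph.map φ) := by
  intro h g e
  refine Subgraph.ext (hφ.image_injective (congrArg Subgraph.verts e)) ?_
  have key : ∀ (f : G.Subgraph) x y, (f.map φ).Adj (φ x) (φ y) ↔ f.Adj x y := by
    refine fun f x y => ⟨?_, fun h => ⟨x, y, h, rfl, rfl⟩⟩
    rintro ⟨a, b, hab, ha, hb⟩
    rwa [← hφ ha, ← hφ hb]
  funext x y
  rw [← key, ← key, e]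

theorem IsHexagon.map {V' : Type v} {G' : SimpleGraph V'} {h : G.Subgraph} (hh : IsHexagon h)
    (φ : G →g G') (hφ : Function.Injective φ) : IsHexagon (h.map φ) := by
  obtain ⟨f⟩ := hh
  refine ⟨f.trans ⟨Equiv.Set.image φ h.verts hφ, ?_⟩⟩
  rintro ⟨a, ha⟩ ⟨b, hb⟩
  simp only [Subgraph.coe_adj, Subgraph.map_adj, Relation.map_apply]
  constructor
  · rintro ⟨a', b', h1, h2, h3⟩
    obtain rfl : a' = a := hφ h2
    obtain rfl : b' = b := hφ h3
    exact h1
  · intro h1; exact ⟨a, b, h1, rfl, rfl⟩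

theorem IsHexagon.of_map {V' : Type v} {G' : SimpleGraph V'} {h : G.Subgraph}
    (φ : G →g G') (hφ : Function.Injective φ) (hh : IsHexagon (h.map φ)) : IsHexagon h := by
  obtain ⟨f⟩ := hh
  refine ⟨f.trans (RelIso.symm ⟨Equiv.Set.image φ h.verts hφ, ?_⟩)⟩
  rintro ⟨a, ha⟩ ⟨b, hb⟩
  simp only [Subgraph.coe_adj, Subgraph.map_adj, Relation.map_apply]
  constructor
  · rintro ⟨a', b', h1, h2, h3⟩
    obtain rfl : a' = a := hφ h2
    obtain rfl : b' = b := hφ h3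
    exact h1
  · intro h1; exact ⟨a, b, h1, rfl, rfl⟩

/-- `m` is the partner function of a perfect matching of `G` restricted to `S`. -/
def IsPartner (G : SimpleGraph V) (S : Set V) (m : V → V) : Prop :=
  ∀ v ∈ S, m v ∈ S ∧ G.Adj v (m v) ∧ m (m v) = v

/-- The sizes of sets of pairwise disjoint hexagons inside `S` that are closed under a perfect
matching of `G` restricted to `S`. -/
def clarSet (G : SimpleGraph V) (S : Set V) : Set ℕ :=
  {n | ∃ m : V → V, IsPartner G S m ∧ ∃ C : Finset G.Subgraph,
    (∀ h ∈ C, IsHexagon h ∧ h.verts ⊆ S ∧ ∀ v ∈ h.verts, h.Adj v (m v)) ∧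
    (C : Set G.Subgraph).Pairwise (fun h g => Disjoint h.verts g.verts) ∧ C.card = n}

/-- A hexagon is alternating for a perfect matching if and only if each of its vertices is matched
along an edge of it. -/
theorem isAlternatingHexagon_iff [Finite V] {M h : G.Subgraph} (hh : IsHexagon h) {m : V → V}
    (hm : ∀ v w, M.Adj v w ↔ w = m v) :
    IsAlternatingHexagon M h ↔ ∀ v ∈ h.verts, h.Adj v (m v) := by
  classical
  have := Fintype.ofFinite V
  -- Handshake count: degrees in `T` are at most 1 and supported on the six vertices of `h`, so
  -- three edges means that all six have degree 1.
  let T : SimpleGraph V := (h ⊓ M).spanningCoe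
  have hT : ∀ v w, T.Adj v w ↔ h.Adj v w ∧ w = m v := fun v w => by
    simp [T, hm]
  have hE : h.edgeSet ∩ M.edgeSet = T.edgeSet := by
    ext e
    induction e with
    | _ x y =>
      rw [SimpleGraph.mem_edgeSet, hT, ← hm]
      rfl
  have hdeg : ∀ v, T.degree v = if h.Adj v (m v) then 1 else 0 := by
    intro v
    have : T.neighborFinset v = if h.Adj v (m v) then {m v} else ∅ := by
      ext w
      rw [mem_neighborFinset, hT]
      split_ifs with h'
      · simp only [Finset.mem_singleton]
        exact ⟨fun h => h.2, fun e => ⟨e ▸ h', e⟩⟩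
      · simp only [Finset.notMem_empty, iff_false]
        rintro ⟨h1, rfl⟩; exact h' h1
    rw [← card_neighborFinset_eq_degree, this]
    split_ifs <;> simp
  have hsum := T.sum_degrees_eq_twice_card_edges
  simp only [hdeg, Finset.sum_boole, Nat.cast_id] at hsum
  have hcard : (h.edgeSet ∩ M.edgeSet).ncard = T.edgeFinset.card := by
    rw [hE, ← coe_edgeFinset, Set.ncard_coe_finset]
  have hv6 : h.verts.toFinset.card = 6 := by
    rw [← Set.ncard_eq_toFinset_card', hh.verts_ncard]
  have hsub : (Finset.univ.filter fun v => h.Adj v (m v)) ⊆ h.verts.toFinset := by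
    intro v hv
    simp only [Finset.mem_filter, Finset.mem_univ, true_and] at hv
    simpa using h.edge_vert hv
  unfold IsAlternatingHexagon
  rw [hcard]
  constructor
  · rintro ⟨-, h3⟩ v hv
    have heq := Finset.eq_of_subset_of_card_le hsub (by omega)
    have : v ∈ h.verts.toFinset := by simpa using hv
    rw [← heq] at this
    simpa using this
  · intro hall
    refine ⟨hh, ?_⟩
    have heq : (Finset.univ.filter fun v => h.Adj v (m v)) = h.verts.toFinset := by
      refine hsub.antisymm fun v hv => ?_
      simpa using hall v (by simpa using hv)
    rw [heq] at hsum
    omega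

theorem clarNumber_eq_sSup_clarSet [Finite V] (G : SimpleGraph V) :
    clarNumber G = sSup (clarSet G Set.univ) := by
  unfold clarNumber
  congr 1
  ext n
  constructor
  · rintro ⟨M, hM, C, hC, hd, hn⟩
    have hM1 : ∀ v, ∃! w, M.Adj v w := fun v => hM.1 (hM.2 v)
    choose m hm hmu using hM1
    have hiff : ∀ v w, M.Adj v w ↔ w = m v := fun v w =>
      ⟨fun h => hmu v w h, fun h => h ▸ hm v⟩
    refine ⟨m, fun v _ => ⟨trivial, (hm v).adj_sub, ?_⟩, C, fun h hh => ?_, hd, hn⟩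
    · exact ((hiff _ _).1 (hm v).symm).symm
    · exact ⟨(hC h hh).1, Set.subset_univ _,
        (isAlternatingHexagon_iff (hC h hh).1 hiff).1 (hC h hh)⟩
  · rintro ⟨m, hm, C, hC, hd, hn⟩
    let M : G.Subgraph :=
      { verts := Set.univ
        Adj := fun v w => w = m v
        adj_sub := by rintro v w rfl; exact (hm v trivial).2.1
        edge_vert := fun _ => trivial
        symm := ⟨by rintro v w rfl; exact (hm v trivial).2.2.symm⟩ }
    have hiff : ∀ v w, M.Adj v w ↔ w = m v := fun v w => Iff.rfl
    refine ⟨M, ⟨fun v _ => ⟨m v, rfl, fun _ h => h⟩, fun _ => trivial⟩, C, fun h hh => ?_, hd, hn⟩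
    exact (isAlternatingHexagon_iff (hC h hh).1 hiff).2 (hC h hh).2.2

/-- Transport along an embedding onto an induced subgraph. -/
theorem clarSet_univ_eq_clarSet_range {V' : Type v} {G' : SimpleGraph V'} (φ : G →g G')
    (hφ : Function.Injective φ) (hind : ∀ x y, G'.Adj (φ x) (φ y) → G.Adj x y) :
    clarSet G Set.univ = clarSet G' (Set.range φ) := by
  classical
  ext n
  constructor
  · rintro ⟨m, hm, C, hC, hd, hn⟩
    have hext : ∀ v, (Function.extend φ (φ ∘ m) id) (φ v) = φ (m v) := fun v =>
      hφ.extend_apply _ _ _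
    -- The values off the range of `φ` are irrelevant, since `IsPartner` constrains `m` only on the
    -- given set.
    refine ⟨Function.extend φ (φ ∘ m) id, ?_,
      C.map ⟨Subgraph.map φ, subgraph_map_injective hφ⟩, ?_, ?_, by simpa using hn⟩
    · rintro _ ⟨v, rfl⟩
      rw [hext, hext, (hm v trivial).2.2]
      exact ⟨⟨_, rfl⟩, φ.map_adj (hm v trivial).2.1, rfl⟩
    · intro h' hh'
      obtain ⟨h, hh, rfl⟩ := Finset.mem_map.1 hh'
      refine ⟨(hC h hh).1.map φ hφ, ?_, ?_⟩
      · rintro _ ⟨v, -, rfl⟩; exact ⟨v, rfl⟩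
      · rintro _ ⟨v, hv, rfl⟩
        rw [hext]
        exact ⟨v, m v, (hC h hh).2.2 v hv, rfl, rfl⟩
    · intro h' hh' g' hg' hne
      obtain ⟨h, hh, rfl⟩ := Finset.mem_map.1 hh'
      obtain ⟨g, hg, rfl⟩ := Finset.mem_map.1 hg'
      have := hd hh hg (fun e => hne (by rw [e]))
      exact (Set.disjoint_image_iff hφ).2 this
  · rintro ⟨m, hm, C, hC, hd, hn⟩
    have hm1 : ∀ v, ∃ w, φ w = m (φ v) := fun v => (hm _ ⟨v, rfl⟩).1
    choose m' hm' using hm1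
    have hmap : ∀ h ∈ C, (h.comap φ).map φ = h := by
      intro h hh
      refine Subgraph.ext ?_ ?_
      · ext z
        constructor
        · rintro ⟨v, hv, rfl⟩; exact hv
        · intro hz
          obtain ⟨v, rfl⟩ := (hC h hh).2.1 hz
          exact ⟨v, hz, rfl⟩
      · funext x y
        refine propext ⟨?_, fun hxy => ?_⟩
        · rintro ⟨v, w, hvw, rfl, rfl⟩; exact hvw.2
        · obtain ⟨v, rfl⟩ := (hC h hh).2.1 (h.edge_vert hxy)
          obtain ⟨w, rfl⟩ := (hC h hh).2.1 (h.edge_vert hxy.symm)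
          exact ⟨v, w, ⟨hind _ _ hxy.adj_sub, hxy⟩, rfl, rfl⟩
    refine ⟨m', fun v _ => ⟨trivial, ?_, ?_⟩, C.image (Subgraph.comap φ), ?_, ?_, ?_⟩
    · exact hind _ _ (by rw [hm']; exact (hm _ ⟨v, rfl⟩).2.1)
    · apply hφ
      rw [hm', hm', (hm _ ⟨v, rfl⟩).2.2]
    · intro h' hh'
      obtain ⟨h, hh, rfl⟩ := Finset.mem_image.1 hh'
      refine ⟨IsHexagon.of_map φ hφ (by rw [hmap h hh]; exact (hC h hh).1),
        Set.subset_univ _, fun v hv => ?_⟩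
      have := (hC h hh).2.2 _ hv
      rw [← hm'] at this
      exact ⟨hind _ _ this.adj_sub, this⟩
    · intro h' hh' g' hg' hne
      obtain ⟨h, hh, rfl⟩ := Finset.mem_image.1 hh'
      obtain ⟨g, hg, rfl⟩ := Finset.mem_image.1 hg'
      have := hd hh hg (fun e => hne (by rw [e]))
      exact Disjoint.preimage φ this
    · rw [Finset.card_image_of_injOn, hn]
      intro h hh g hg e
      rw [← hmap h hh, ← hmap g hg]
      exact congrArg _ e

end Hexagons

/-! ### The exchange argument for one pendant hexagon. -/

section AddHexagon

variable {V : Type u} {G : SimpleGraph V}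

/-- The hexagon `H' = a₁ x₁ a₂ b₂ y₁ b₁` hangs at the edge `a₁ b₁` of the hexagon
`H = a₀ x₀ a₁ b₁ y₀ b₀`, in the graph induced on `S ∪ {x₁, a₂, b₂, y₁}`. -/
structure IsPendantHexagon (G : SimpleGraph V) (S : Set V) (H H' : G.Subgraph)
    (a₀ x₀ a₁ b₁ y₀ b₀ x₁ a₂ b₂ y₁ : V) : Prop where
  hexH : IsHexagon H
  hexH' : IsHexagon H'
  vertsH : H.verts = {a₀, x₀, a₁, b₁, y₀, b₀}
  vertsH' : H'.verts = {a₁, x₁, a₂, b₂, y₁, b₁}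
  subset : H.verts ⊆ S
  disj : ∀ v ∈ S, v ≠ x₁ ∧ v ≠ a₂ ∧ v ≠ b₂ ∧ v ≠ y₁
  nodup : [a₀, x₀, a₁, b₁, y₀, b₀].Nodup
  nodup' : [x₁, a₂, b₂, y₁].Nodup
  adj_a₀x₀ : H.Adj a₀ x₀
  adj_a₁b₁ : H.Adj a₁ b₁
  adj_b₀y₀ : H.Adj b₀ y₀
  adj_x₁a₂ : G.Adj x₁ a₂
  adj_b₂y₁ : G.Adj b₂ y₁
  nbr_x₁ : ∀ z ∈ S ∪ {x₁, a₂, b₂, y₁}, G.Adj x₁ z → z = a₁ ∨ z = a₂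
  nbr_a₂ : ∀ z ∈ S ∪ {x₁, a₂, b₂, y₁}, G.Adj a₂ z → z = x₁ ∨ z = b₂
  nbr_b₂ : ∀ z ∈ S ∪ {x₁, a₂, b₂, y₁}, G.Adj b₂ z → z = a₂ ∨ z = y₁
  nbr_y₁ : ∀ z ∈ S ∪ {x₁, a₂, b₂, y₁}, G.Adj y₁ z → z = b₂ ∨ z = b₁
  nbr_a₁ : ∀ z ∈ S ∪ {x₁, a₂, b₂, y₁}, G.Adj a₁ z → z = x₀ ∨ z = b₁ ∨ z = x₁
  nbr_b₁ : ∀ z ∈ S ∪ {x₁, a₂, b₂, y₁}, G.Adj b₁ z → z = y₀ ∨ z = a₁ ∨ z = y₁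
  nbr_x₀ : ∀ z ∈ S ∪ {x₁, a₂, b₂, y₁}, G.Adj x₀ z → z = a₀ ∨ z = a₁
  nbr_y₀ : ∀ z ∈ S ∪ {x₁, a₂, b₂, y₁}, G.Adj y₀ z → z = b₀ ∨ z = b₁

namespace IsPendantHexagon

variable {S : Set V} {H H' : G.Subgraph} {a₀ x₀ a₁ b₁ y₀ b₀ x₁ a₂ b₂ y₁ : V}

theorem clarSet_subset (D : IsPendantHexagon G S H H' a₀ x₀ a₁ b₁ y₀ b₀ x₁ a₂ b₂ y₁) :
    clarSet G S ⊆ clarSet G (S ∪ {x₁, a₂, b₂, y₁}) := by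
  classical
  rintro n ⟨m, hm, C, hC, hd, hn⟩
  have hnd := D.nodup'
  simp only [List.nodup_cons, List.mem_cons, List.not_mem_nil, or_false, not_or,
    not_false_eq_true, List.nodup_nil, and_true] at hnd
  obtain ⟨⟨h1, h2, h3⟩, ⟨h4, h5⟩, h6⟩ := hnd
  let m' : V → V := fun v => if v = x₁ then a₂ else if v = a₂ then x₁ else
    if v = b₂ then y₁ else if v = y₁ then b₂ else m v
  have hmS : ∀ v ∈ S, m' v = m v := fun v hv => by
    obtain ⟨g1, g2, g3, g4⟩ := D.disj v hv
    simp [m', g1, g2, g3, g4]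
  have e1 : m' x₁ = a₂ := by simp [m']
  have e2 : m' a₂ = x₁ := by simp [m', Ne.symm h1]
  have e3 : m' b₂ = y₁ := by simp [m', Ne.symm h2, Ne.symm h4]
  have e4 : m' y₁ = b₂ := by simp [m', Ne.symm h3, Ne.symm h5, Ne.symm h6]
  refine ⟨m', ?_, C, fun h hh => ⟨(hC h hh).1,
    (hC h hh).2.1.trans Set.subset_union_left, fun v hv => ?_⟩, hd, hn⟩
  · rintro v (hv | rfl | rfl | rfl | rfl)
    · obtain ⟨g1, g2, g3⟩ := hm v hv
      rw [hmS v hv, hmS _ g1]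
      exact ⟨Or.inl g1, g2, g3⟩
    · rw [e1, e2]; exact ⟨by simp, D.adj_x₁a₂, rfl⟩
    · rw [e2, e1]; exact ⟨by simp, D.adj_x₁a₂.symm, rfl⟩
    · rw [e3, e4]; exact ⟨by simp, D.adj_b₂y₁, rfl⟩
    · rw [e4, e3]; exact ⟨by simp, D.adj_b₂y₁.symm, rfl⟩
  · rw [hmS v ((hC h hh).2.1 hv)]
    exact (hC h hh).2.2 v hv

theorem x₀_notMem (D : IsPendantHexagon G S H H' a₀ x₀ a₁ b₁ y₀ b₀ x₁ a₂ b₂ y₁) :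
    x₀ ∉ H'.verts := by
  obtain ⟨h1, h2, h3, h4⟩ := D.disj x₀ (D.subset (by rw [D.vertsH]; simp))
  have hnd := D.nodup
  simp only [List.nodup_cons, List.mem_cons, not_or] at hnd
  rw [D.vertsH']
  rintro (h | h | h | h | h | h)
  exacts [hnd.2.1.1 h, h1 h, h2 h, h3 h, h4 h, hnd.2.1.2.1 h]

theorem y₀_notMem (D : IsPendantHexagon G S H H' a₀ x₀ a₁ b₁ y₀ b₀ x₁ a₂ b₂ y₁) :
    y₀ ∉ H'.verts := by
  obtain ⟨h1, h2, h3, h4⟩ := D.disj y₀ (D.subset (by rw [D.vertsH]; simp))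
  have hnd := D.nodup
  simp only [List.nodup_cons, List.mem_cons, not_or] at hnd
  rw [D.vertsH']
  rintro (h | h | h | h | h | h)
  exacts [hnd.2.2.1.2.1 h.symm, h1 h, h2 h, h3 h, h4 h, hnd.2.2.2.1.1 h.symm]

/-- The only hexagon through a new vertex is `H'`. -/
theorem eq_of_mem_new (D : IsPendantHexagon G S H H' a₀ x₀ a₁ b₁ y₀ b₀ x₁ a₂ b₂ y₁)
    {h : G.Subgraph} (hh : IsHexagon h) (hS : h.verts ⊆ S ∪ {x₁, a₂, b₂, y₁})
    (hnew : x₁ ∈ h.verts ∨ a₂ ∈ h.verts ∨ b₂ ∈ h.verts ∨ y₁ ∈ h.verts) : h = H' := by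
  have key : ∀ {v p q : V}, (∀ z ∈ S ∪ {x₁, a₂, b₂, y₁}, G.Adj v z → z = p ∨ z = q) →
      v ∈ h.verts → h.Adj v p ∧ h.Adj v q := fun hN hv =>
    hh.adj_of_forall hv fun z hz => hN z (hS (h.edge_vert hz.symm)) hz.adj_sub
  have k1 : x₁ ∈ h.verts → h.Adj x₁ a₁ ∧ h.Adj x₁ a₂ := key D.nbr_x₁
  have k2 : a₂ ∈ h.verts → h.Adj a₂ x₁ ∧ h.Adj a₂ b₂ := key D.nbr_a₂
  have k3 : b₂ ∈ h.verts → h.Adj b₂ a₂ ∧ h.Adj b₂ y₁ := key D.nbr_b₂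
  have k4 : y₁ ∈ h.verts → h.Adj y₁ b₂ ∧ h.Adj y₁ b₁ := key D.nbr_y₁
  have ev : ∀ {p q}, h.Adj p q → q ∈ h.verts := fun hpq => h.edge_vert hpq.symm
  have ha : a₂ ∈ h.verts := by
    rcases hnew with hv | hv | hv | hv
    · exact ev (k1 hv).2
    · exact hv
    · exact ev (k3 hv).1
    · exact ev (k3 (ev (k4 hv).1)).1
  have hb := ev (k2 ha).2
  have hx := ev (k2 ha).1
  have hy := ev (k3 hb).2
  have ha1 := ev (k1 hx).1
  have hb1 := ev (k4 hy).2
  have hsub : H'.verts ⊆ h.verts := by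
    rw [D.vertsH']
    rintro v (rfl | rfl | rfl | rfl | rfl | rfl) <;> assumption
  have hv : H'.verts = h.verts := by
    refine Set.eq_of_subset_of_ncard_le hsub ?_ (Set.finite_of_ncard_ne_zero ?_)
    · rw [hh.verts_ncard, D.hexH'.verts_ncard]
    · rw [hh.verts_ncard]; decide
  have hx0 : x₀ ∉ h.verts := hv ▸ D.x₀_notMem
  have hy0 : y₀ ∉ h.verts := hv ▸ D.y₀_notMem
  -- The new vertices force the path from `a₁` to `b₁`, which already uses all six vertices; `x₀` is
  -- therefore excluded, and the cycle must close through `b₁`.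
  have hab : h.Adj a₁ b₁ := by
    refine (hh.adj_of_forall (a := x₁) ha1 fun z hz => ?_).2
    have hz' := ev hz
    rcases D.nbr_a₁ z (hS hz') hz.adj_sub with rfl | rfl | rfl
    · exact absurd hz' hx0
    · exact Or.inr rfl
    · exact Or.inl rfl
  refine (D.hexH'.le_antisymm hh ⟨hsub, fun p q hpq => ?_⟩).symm
  have hp : p ∈ H'.verts := H'.edge_vert hpq
  have hq : q ∈ S ∪ {x₁, a₂, b₂, y₁} := hS (hsub (H'.edge_vert hpq.symm))
  have hq' : q ∈ h.verts := hsub (H'.edge_vert hpq.symm)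
  rw [D.vertsH'] at hp
  rcases hp with rfl | rfl | rfl | rfl | rfl | rfl
  · rcases D.nbr_a₁ q hq hpq.adj_sub with rfl | rfl | rfl
    · exact absurd hq' hx0
    · exact hab
    · exact (k1 hx).1.symm
  · rcases D.nbr_x₁ q hq hpq.adj_sub with rfl | rfl
    · exact (k1 hx).1
    · exact (k1 hx).2
  · rcases D.nbr_a₂ q hq hpq.adj_sub with rfl | rfl
    · exact (k2 ha).1
    · exact (k2 ha).2
  · rcases D.nbr_b₂ q hq hpq.adj_sub with rfl | rfl
    · exact (k3 hb).1
    · exact (k3 hb).2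
  · rcases D.nbr_y₁ q hq hpq.adj_sub with rfl | rfl
    · exact (k4 hy).1
    · exact (k4 hy).2
  · rcases D.nbr_b₁ q hq hpq.adj_sub with rfl | rfl | rfl
    · exact absurd hq' hy0
    · exact hab.symm
    · exact (k4 hy).2.symm

theorem subset_of_ne (D : IsPendantHexagon G S H H' a₀ x₀ a₁ b₁ y₀ b₀ x₁ a₂ b₂ y₁)
    {h : G.Subgraph} (hh : IsHexagon h) (hS : h.verts ⊆ S ∪ {x₁, a₂, b₂, y₁})
    (hne : h ≠ H') : h.verts ⊆ S := by
  intro v hv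
  rcases hS hv with h1 | rfl | rfl | rfl | rfl
  · exact h1
  all_goals exact absurd (D.eq_of_mem_new hh hS (by tauto)) hne

/-- A matching in which the end `a₂ b₂` is matched across, or in which `H'` is alternating, can be
rerouted through `a₁ b₁`. -/
theorem exists_reroute (D : IsPendantHexagon G S H H' a₀ x₀ a₁ b₁ y₀ b₀ x₁ a₂ b₂ y₁) {m : V → V}
    (hm : IsPartner G (S ∪ {x₁, a₂, b₂, y₁}) m)
    (ha : m a₁ = x₁ ∨ m a₁ = b₁) (hb : m b₁ = y₁ ∨ m b₁ = a₁) :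
    ∃ m' : V → V, IsPartner G S m' ∧ (∀ v, v ≠ a₁ → v ≠ b₁ → m' v = m v) ∧
      m x₀ = a₀ ∧ m a₀ = x₀ ∧ m y₀ = b₀ ∧ m b₀ = y₀ ∧ m' a₁ = b₁ ∧ m' b₁ = a₁ := by
  classical
  have hnd := D.nodup
  simp only [List.nodup_cons, List.mem_cons, List.not_mem_nil, or_false, not_or,
    not_false_eq_true, List.nodup_nil, and_true] at hnd
  have hHS : ∀ v, v = a₀ ∨ v = x₀ ∨ v = a₁ ∨ v = b₁ ∨ v = y₀ ∨ v = b₀ → v ∈ S := fun v hv =>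
    D.subset (by rw [D.vertsH]; simpa using hv)
  have hx0S : x₀ ∈ S := hHS _ (by tauto)
  have hy0S : y₀ ∈ S := hHS _ (by tauto)
  have ha1S : a₁ ∈ S := hHS _ (by tauto)
  have hb1S : b₁ ∈ S := hHS _ (by tauto)
  have inl : ∀ {v}, v ∈ S → v ∈ S ∪ {x₁, a₂, b₂, y₁} := fun h => Or.inl h
  have hx0d := D.disj _ hx0S
  have hy0d := D.disj _ hy0S
  have ha1d := D.disj _ ha1S
  have hb1d := D.disj _ hb1S
  have hx0 : m x₀ = a₀ := by
    obtain ⟨g1, g2, g3⟩ := hm _ (inl hx0S)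
    rcases D.nbr_x₀ _ g1 g2 with h | h
    · exact h
    · rw [h] at g3; grind
  have hy0 : m y₀ = b₀ := by
    obtain ⟨g1, g2, g3⟩ := hm _ (inl hy0S)
    rcases D.nbr_y₀ _ g1 g2 with h | h
    · exact h
    · rw [h] at g3; grind
  have ha0 : m a₀ = x₀ := by rw [← hx0]; exact (hm _ (inl hx0S)).2.2
  have hb0 : m b₀ = y₀ := by rw [← hy0]; exact (hm _ (inl hy0S)).2.2
  let m' : V → V := fun v => if v = a₁ then b₁ else if v = b₁ then a₁ else m v
  have e1 : m' a₁ = b₁ := by simp [m']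
  have e2 : m' b₁ = a₁ := by simp [m', D.adj_a₁b₁.ne.symm]
  have e3 : ∀ v, v ≠ a₁ → v ≠ b₁ → m' v = m v := fun v h1 h2 => by simp [m', h1, h2]
  refine ⟨m', ?_, e3, hx0, ha0, hy0, hb0, e1, e2⟩
  intro v hv
  by_cases hva : v = a₁
  · subst hva; rw [e1, e2]; exact ⟨hb1S, D.adj_a₁b₁.adj_sub, rfl⟩
  by_cases hvb : v = b₁
  · subst hvb; rw [e2, e1]; exact ⟨ha1S, D.adj_a₁b₁.adj_sub.symm, rfl⟩
  obtain ⟨g1, g2, g3⟩ := hm v (inl hv)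
  have hvd := D.disj v hv
  have hmva : m v ≠ a₁ := fun h => by rw [h] at g3; grind
  have hmvb : m v ≠ b₁ := fun h => by rw [h] at g3; grind
  rw [e3 v hva hvb, e3 _ hmva hmvb]
  refine ⟨?_, g2, g3⟩
  -- An old vertex with a new partner would be `a₁` or `b₁`, as no other old vertex is adjacent to a
  -- new one.
  rcases g1 with h | h | h | h | h
  · exact h
  · rw [h] at g2
    have := D.nbr_x₁ v (inl hv) g2.symm
    tauto
  · rw [h] at g2
    have := D.nbr_a₂ v (inl hv) g2.symm
    tauto
  · rw [h] at g2
    have := D.nbr_b₂ v (inl hv) g2.symm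
    tauto
  · rw [h] at g2
    have := D.nbr_y₁ v (inl hv) g2.symm
    tauto

/-- If `H'` is in the family it is traded for `H`; otherwise every member already lies in `S`, and
only the matching may need rerouting. -/
theorem subset_clarSet (D : IsPendantHexagon G S H H' a₀ x₀ a₁ b₁ y₀ b₀ x₁ a₂ b₂ y₁) :
    clarSet G (S ∪ {x₁, a₂, b₂, y₁}) ⊆ clarSet G S := by
  classical
  rintro n ⟨m, hm, C, hC, hd, hn⟩
  have hnd := D.nodup
  have hnd' := D.nodup'
  simp only [List.nodup_cons, List.mem_cons, List.not_mem_nil, or_false, not_or,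
    not_false_eq_true, List.nodup_nil, and_true] at hnd hnd'
  have hHS : ∀ v, v = a₀ ∨ v = x₀ ∨ v = a₁ ∨ v = b₁ ∨ v = y₀ ∨ v = b₀ → v ∈ S := fun v hv =>
    D.subset (by rw [D.vertsH]; simpa using hv)
  have ha1S : a₁ ∈ S := hHS _ (by tauto)
  have hb1S : b₁ ∈ S := hHS _ (by tauto)
  have inl : ∀ {v}, v ∈ S → v ∈ S ∪ {x₁, a₂, b₂, y₁} := fun h => Or.inl h
  have hx1T : x₁ ∈ S ∪ {x₁, a₂, b₂, y₁} := by simp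
  have ha2T : a₂ ∈ S ∪ {x₁, a₂, b₂, y₁} := by simp
  have hb2T : b₂ ∈ S ∪ {x₁, a₂, b₂, y₁} := by simp
  have hy1T : y₁ ∈ S ∪ {x₁, a₂, b₂, y₁} := by simp
  by_cases hH' : H' ∈ C
  · have hx0' := D.x₀_notMem
    have hy0' := D.y₀_notMem
    have ha1' : a₁ ∈ H'.verts := by rw [D.vertsH']; simp
    have hb1' : b₁ ∈ H'.verts := by rw [D.vertsH']; simp
    obtain ⟨m', hm', hmm, hx0, ha0, hy0, hb0, e1, e2⟩ := D.exists_reroute hm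
      (by
        have h1 := (hC _ hH').2.2 _ ha1'
        rcases D.nbr_a₁ _ (hm _ (inl ha1S)).1 h1.adj_sub with h | h | h
        · exact absurd (h ▸ H'.edge_vert h1.symm) hx0'
        · exact Or.inr h
        · exact Or.inl h)
      (by
        have h1 := (hC _ hH').2.2 _ hb1'
        rcases D.nbr_b₁ _ (hm _ (inl hb1S)).1 h1.adj_sub with h | h | h
        · exact absurd (h ▸ H'.edge_vert h1.symm) hy0'
        · exact Or.inr h
        · exact Or.inl h)
    have hdisj : ∀ h ∈ C, h ≠ H' → ∀ v ∈ h.verts, v ∉ H'.verts := fun h hh hne v hv hv' =>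
      Set.disjoint_left.1 (hd hh hH' hne) hv hv'
    have hdisjH : ∀ h ∈ C, h ≠ H' → Disjoint h.verts H.verts := by
      intro h hh hne
      obtain ⟨hhex, hhT, hhm⟩ := hC h hh
      -- A hexagon through `x₀` uses both of its neighbours, in particular `a₁`, which belongs to
      -- `H'`.
      have hx : x₀ ∉ h.verts := fun hv => hdisj h hh hne a₁ (h.edge_vert
        (hhex.adj_of_forall hv fun z hz =>
          D.nbr_x₀ z (hhT (h.edge_vert hz.symm)) hz.adj_sub).2.symm) ha1'
      have hy : y₀ ∉ h.verts := fun hv => hdisj h hh hne b₁ (h.edge_vert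
        (hhex.adj_of_forall hv fun z hz =>
          D.nbr_y₀ z (hhT (h.edge_vert hz.symm)) hz.adj_sub).2.symm) hb1'
      refine Set.disjoint_left.2 fun v hv hvH => ?_
      rw [D.vertsH] at hvH
      rcases hvH with rfl | rfl | rfl | rfl | rfl | rfl
      · exact hx (by rw [← ha0]; exact h.edge_vert (hhm _ hv).symm)
      · exact hx hv
      · exact hdisj h hh hne _ hv ha1'
      · exact hdisj h hh hne _ hv hb1'
      · exact hy hv
      · exact hy (by rw [← hb0]; exact h.edge_vert (hhm _ hv).symm)
    have hHne : H ≠ H' := fun h => hx0' (by rw [← h, D.vertsH]; simp)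
    have hHC : H ∉ C := fun h => by
      have := hdisjH H h hHne
      exact Set.disjoint_left.1 this (H.edge_vert D.adj_a₀x₀) (H.edge_vert D.adj_a₀x₀)
    refine ⟨m', hm', insert H (C.erase H'), ?_, ?_, ?_⟩
    · intro h hh
      rcases Finset.mem_insert.1 hh with rfl | hh
      · refine ⟨D.hexH, D.subset, fun v hv => ?_⟩
        rw [D.vertsH] at hv
        rcases hv with rfl | rfl | rfl | rfl | rfl | rfl
        · rw [hmm _ (by tauto) (by tauto), ha0]; exact D.adj_a₀x₀
        · rw [hmm _ (by tauto) (by tauto), hx0]; exact D.adj_a₀x₀.symm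
        · rw [e1]; exact D.adj_a₁b₁
        · rw [e2]; exact D.adj_a₁b₁.symm
        · rw [hmm _ (by grind) (by grind), hy0]; exact D.adj_b₀y₀.symm
        · rw [hmm _ (by grind) (by grind), hb0]; exact D.adj_b₀y₀
      · obtain ⟨hne, hh⟩ := Finset.mem_erase.1 hh
        obtain ⟨hhex, hhT, hhm⟩ := hC h hh
        refine ⟨hhex, D.subset_of_ne hhex hhT hne, fun v hv => ?_⟩
        rw [hmm v (fun e => hdisj h hh hne v hv (e ▸ ha1'))
          (fun e => hdisj h hh hne v hv (e ▸ hb1'))]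
        exact hhm v hv
    · rw [Finset.coe_insert, Set.pairwise_insert]
      refine ⟨fun h hh g hg hne => hd (Finset.mem_of_mem_erase hh) (Finset.mem_of_mem_erase hg)
        hne, fun h hh _ => ?_⟩
      obtain ⟨hne, hh⟩ := Finset.mem_erase.1 hh
      exact ⟨(hdisjH h hh hne).symm, hdisjH h hh hne⟩
    · rw [Finset.card_insert_of_notMem (fun h => hHC (Finset.mem_of_mem_erase h)),
        Finset.card_erase_of_mem hH', hn]
      have : 0 < C.card := Finset.card_pos.2 ⟨_, hH'⟩
      omega
  · have hCS : ∀ h ∈ C, h.verts ⊆ S := fun h hh =>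
      D.subset_of_ne (hC h hh).1 (hC h hh).2.1 fun e => hH' (e ▸ hh)
    have iv : ∀ {v}, v ∈ S ∪ {x₁, a₂, b₂, y₁} → m (m v) = v := fun h => (hm _ h).2.2
    have nx := D.nbr_x₁ _ (hm _ hx1T).1 (hm _ hx1T).2.1
    have na := D.nbr_a₂ _ (hm _ ha2T).1 (hm _ ha2T).2.1
    have nb := D.nbr_b₂ _ (hm _ hb2T).1 (hm _ hb2T).2.1
    have ny := D.nbr_y₁ _ (hm _ hy1T).1 (hm _ hy1T).2.1
    have ix := iv hx1T
    have ia := iv ha2T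
    have ib := iv hb2T
    have iy := iv hy1T
    -- Either `a₂ x₁` and `b₂ y₁` are matched, and the matching restricts to `S`; or `a₂ b₂` is,
    -- which forces `x₁ a₁` and `y₁ b₁`.
    rcases na with na | na
    · have hb : m b₂ = y₁ := by grind
      have hx : m x₁ = a₂ := by grind
      have hy : m y₁ = b₂ := by grind
      refine ⟨m, fun v hv => ?_, C, fun h hh => ⟨(hC h hh).1, hCS h hh, (hC h hh).2.2⟩, hd, hn⟩
      obtain ⟨g1, g2, g3⟩ := hm v (inl hv)
      have hvd := D.disj v hv
      refine ⟨?_, g2, g3⟩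
      rcases g1 with h | h | h | h | h
      · exact h
      all_goals
        rw [h] at g3
        exact absurd g3 (by grind)
    · have hb : m b₂ = a₂ := by grind
      have hx : m x₁ = a₁ := by grind
      have hy : m y₁ = b₁ := by grind
      have ha1 : m a₁ = x₁ := by rw [← hx, ix]
      have hb1 : m b₁ = y₁ := by rw [← hy, iy]
      obtain ⟨m', hm', hmm, -⟩ := D.exists_reroute hm (Or.inl ha1) (Or.inl hb1)
      refine ⟨m', hm', C, fun h hh => ⟨(hC h hh).1, hCS h hh, fun v hv => ?_⟩, hd, hn⟩
      have hv' := (hC h hh).2.2 v hv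
      have hmS := hCS h hh (h.edge_vert hv'.symm)
      have hmd := D.disj _ hmS
      -- The partners of `a₁` and `b₁` lie outside `S`, so no member of `C` contains either vertex.
      rw [hmm v (by rintro rfl; tauto) (by rintro rfl; tauto)]
      exact hv'

/-- Adding a pendant hexagon in line with its neighbour does not change the Clar set. -/
theorem clarSet_eq (D : IsPendantHexagon G S H H' a₀ x₀ a₁ b₁ y₀ b₀ x₁ a₂ b₂ y₁) :
    clarSet G (S ∪ {x₁, a₂, b₂, y₁}) = clarSet G S :=
  D.subset_clarSet.antisymm D.clarSet_subset

end IsPendantHexagon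

end AddHexagon

/-! ### From linearity to the pendant configuration. -/

section LinearHexagon

variable {V : Type u} {G : SimpleGraph V}

/-- Distinct hexagons of a benzenoid graph with a common vertex share exactly one edge. -/
theorem IsBenzenoid.exists_common_edge (hG : IsBenzenoid G) {h g : G.Subgraph} (hh : IsHexagon h)
    (hg : IsHexagon g) (hne : h ≠ g) {v : V} (hv : v ∈ h.verts) (hv' : v ∈ g.verts) :
    ∃ x y : V, h.Adj x y ∧ g.Adj x y ∧ h.verts ∩ g.verts = {x, y} :=
  (hG.2.2.1 h g hh hg hne).resolve_left fun hd => Set.disjoint_left.1 hd hv hv'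

theorem IsBenzenoid.hexAdj_of_mem (hG : IsBenzenoid G) {h g : G.Subgraph} (hh : IsHexagon h)
    (hg : IsHexagon g) (hne : h ≠ g) {v : V} (hv : v ∈ h.verts) (hv' : v ∈ g.verts) :
    HexAdj h g := by
  obtain ⟨x, y, h1, h2, -⟩ := hG.exists_common_edge hh hg hne hv hv'
  exact ⟨hh, hg, hne, s(x, y), h1, h2⟩

theorem HexAdj.exists_common_edge (hG : IsBenzenoid G) {h g : G.Subgraph} (hhg : HexAdj h g) :
    ∃ x y : V, h.Adj x y ∧ g.Adj x y ∧ h.verts ∩ g.verts = {x, y} := by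
  obtain ⟨hh, hg, hne, e, he, he'⟩ := hhg
  induction e with
  | _ x y => exact hG.exists_common_edge hh hg hne (h.edge_vert he) (g.edge_vert he')

/-- In a linear hexagon `c 0, …, c 5` that meets an adjacent hexagon in `c 0, c 1`, the vertices
`c 2` and `c 5` lie on no edge outside the hexagon. -/
theorem IsLinear.adj_of_adj [Finite V] (hG : IsBenzenoid G) {h g : G.Subgraph}
    (hl : IsLinear h) (hhg : HexAdj h g) {c : Fin 6 → V} (hc : Function.Injective c)
    (hr : Set.range c = h.verts) (hadj : ∀ i j, h.Adj (c i) (c j) ↔ j = i + 1 ∨ i = j + 1)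
    (hcg : h.verts ∩ g.verts = {c 0, c 1}) (t : Fin 6) (ht : t = 2 ∨ t = 5) (z : V)
    (hz : G.Adj (c t) z) : h.Adj (c t) z := by
  obtain ⟨hh, h2, x, y, -, hxy, hnadj⟩ := hl
  obtain ⟨f, hgf⟩ : ∃ f, HexAdj h f ∧ ∀ f', HexAdj h f' → f' = g ∨ f' = f := by
    obtain ⟨f₁, f₂, -, hf⟩ := Set.ncard_eq_two.1 h2
    have hmem : ∀ f', HexAdj h f' ↔ f' = f₁ ∨ f' = f₂ := fun f' => by
      change f' ∈ {g | HexAdj h g} ↔ _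
      rw [hf]; rfl
    rcases (hmem g).1 hhg with rfl | rfl
    · exact ⟨f₂, (hmem _).2 (Or.inr rfl), fun f' h => (hmem f').1 h⟩
    · exact ⟨f₁, (hmem _).2 (Or.inl rfl), fun f' h => ((hmem f').1 h).symm⟩
  obtain ⟨hf, hall⟩ := hgf
  obtain ⟨p, q, hpq, -, hpqf⟩ := hf.exists_common_edge hG
  obtain ⟨i, hi⟩ : ∃ i, h.verts ∩ f.verts = {c i, c (i + 1)} := by
    have hp := h.edge_vert hpq
    have hq := h.edge_vert hpq.symm
    rw [← hr] at hp hq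
    obtain ⟨i, rfl⟩ := hp
    obtain ⟨j, rfl⟩ := hq
    rcases (hadj i j).1 hpq with rfl | rfl
    · exact ⟨i, hpqf⟩
    · exact ⟨j, by rw [hpqf, Set.pair_comm]⟩
  have hmem : ∀ s, c s ∈ h.verts := fun s => hr ▸ ⟨s, rfl⟩
  -- An outside edge would lie in another hexagon, hence in `g` or `f`, which meet `h` only in the
  -- listed vertices.
  have free : ∀ s, s ≠ 0 → s ≠ 1 → s ≠ i → s ≠ i + 1 → ∀ z, G.Adj (c s) z → h.Adj (c s) z := by
    intro s s0 s1 si si' z hz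
    obtain ⟨e, he, hez⟩ := hG.exists_hexagon_adj hz
    by_cases hne : h = e
    · rwa [hne]
    rcases hall e (hG.hexAdj_of_mem hh he hne (hmem s) (e.edge_vert hez)) with rfl | rfl
    · have : c s ∈ h.verts ∩ e.verts := ⟨hmem s, e.edge_vert hez⟩
      rw [hcg] at this
      rcases this with h' | h'
      exacts [absurd (hc h') s0, absurd (hc h') s1]
    · have : c s ∈ h.verts ∩ e.verts := ⟨hmem s, e.edge_vert hez⟩
      rw [hi] at this
      rcases this with h' | h'
      exacts [absurd (hc h') si, absurd (hc h') si']
  have hdeg : ∀ s, s ≠ 0 → s ≠ 1 → s ≠ i → s ≠ i + 1 → c s = x ∨ c s = y := by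
    intro s s0 s1 si si'
    have hs : c s ∈ {z ∈ h.verts | (G.neighborSet z).ncard = 2} := by
      refine ⟨hmem s, ?_⟩
      have : G.neighborSet (c s) = h.neighborSet (c s) :=
        Set.Subset.antisymm (fun z hz => free s s0 s1 si si' z hz) (fun z hz => hz.adj_sub)
      rw [this, hh.neighborSet_ncard (hmem s)]
    rw [hxy] at hs
    exact hs
  -- Unless the two shared edges are opposite, two consecutive vertices are free. They have degree
  -- 2, so they are `x` and `y`, which are not adjacent.
  have hi3 : i = 3 := by
    by_contra hi3
    have hex : ∀ i : Fin 6, i ≠ 3 → ∃ s : Fin 6, (s ≠ 0 ∧ s ≠ 1 ∧ s ≠ i ∧ s ≠ i + 1) ∧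
        (s + 1 ≠ 0 ∧ s + 1 ≠ 1 ∧ s + 1 ≠ i ∧ s + 1 ≠ i + 1) := by decide
    obtain ⟨s, ⟨a1, a2, a3, a4⟩, b1, b2, b3, b4⟩ := hex i hi3
    have hss : G.Adj (c s) (c (s + 1)) := ((hadj _ _).2 (Or.inl rfl)).adj_sub
    rcases hdeg s a1 a2 a3 a4 with e | e <;> rcases hdeg (s + 1) b1 b2 b3 b4 with e' | e'
    · exact hss.ne (e.trans e'.symm)
    · rw [e, e'] at hss; exact hnadj hss
    · rw [e, e'] at hss; exact hnadj hss.symm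
    · exact hss.ne (e.trans e'.symm)
  subst hi3
  rcases ht with rfl | rfl
  · exact free 2 (by decide) (by decide) (by decide) (by decide) z hz
  · exact free 5 (by decide) (by decide) (by decide) (by decide) z hz

/-- Adding to `S` a hexagon `H'` attached to a hexagon `H` opposite to the rest of the graph does
not change the Clar set. -/
theorem clarSet_union_hexagon {S : Set V} {H H' : G.Subgraph} (hH : IsHexagon H)
    (hH' : IsHexagon H') {c d : Fin 6 → V} (hc : Function.Injective c)
    (hcr : Set.range c = H.verts) (hcadj : ∀ i j, H.Adj (c i) (c j) ↔ j = i + 1 ∨ i = j + 1)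
    (hd : Function.Injective d) (hdr : Set.range d = H'.verts)
    (hdadj : ∀ i j, H'.Adj (d i) (d j) ↔ j = i + 1 ∨ i = j + 1)
    (h0 : d 0 = c 0) (h1 : d 1 = c 1) (hHH' : H.verts ∩ H'.verts = {c 0, c 1})
    (hHS : H.verts ⊆ S) (hS : S ∩ H'.verts ⊆ H.verts)
    (hnew : ∀ x ∈ H'.verts, ∀ z ∈ S ∪ H'.verts, G.Adj x z → H'.Adj x z ∨ H.Adj x z)
    (hold : ∀ t : Fin 6, t = 2 ∨ t = 5 → ∀ z ∈ S ∪ H'.verts, G.Adj (c t) z → H.Adj (c t) z) :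
    clarSet G (S ∪ H'.verts) = clarSet G S := by
  have hcmem : ∀ i, c i ∈ H.verts := fun i => hcr ▸ ⟨i, rfl⟩
  have hdmem : ∀ i, d i ∈ H'.verts := fun i => hdr ▸ ⟨i, rfl⟩
  have hcn : ∀ i z, H.Adj (c i) z → z = c (i + 1) ∨ z = c (i - 1) := by
    intro i z hz
    obtain ⟨j, rfl⟩ : z ∈ Set.range c := hcr ▸ H.edge_vert hz.symm
    rcases (hcadj i j).1 hz with rfl | rfl
    · exact Or.inl rfl
    · right; simp
  have hdn : ∀ i z, H'.Adj (d i) z → z = d (i + 1) ∨ z = d (i - 1) := by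
    intro i z hz
    obtain ⟨j, rfl⟩ : z ∈ Set.range d := hdr ▸ H'.edge_vert hz.symm
    rcases (hdadj i j).1 hz with rfl | rfl
    · exact Or.inl rfl
    · right; simp
  have hdS : ∀ i, i ≠ 0 → i ≠ 1 → d i ∉ S := by
    intro i i0 i1 hi
    have : d i ∈ H.verts ∩ H'.verts := ⟨hS ⟨hi, hdmem i⟩, hdmem i⟩
    rw [hHH', ← h0, ← h1] at this
    rcases this with h | h
    exacts [i0 (hd h), i1 (hd h)]
  have hnd : ∀ i, i ≠ 0 → i ≠ 1 → ∀ z ∈ S ∪ H'.verts, G.Adj (d i) z →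
      z = d (i + 1) ∨ z = d (i - 1) := by
    intro i i0 i1 z hz hiz
    rcases hnew _ (hdmem i) z hz hiz with h | h
    · exact hdn i z h
    · exact absurd (hHS (H.edge_vert h)) (hdS i i0 i1)
  have hS' : S ∪ H'.verts = S ∪ {d 5, d 4, d 3, d 2} := by
    ext v
    constructor
    · rintro (hv | hv)
      · exact Or.inl hv
      · rw [← hdr] at hv
        obtain ⟨i, rfl⟩ := hv
        fin_cases i
        · left; change d 0 ∈ S; rw [h0]; exact hHS (hcmem 0)
        · left; change d 1 ∈ S; rw [h1]; exact hHS (hcmem 1)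
        all_goals simp
    · rintro (hv | rfl | rfl | rfl | rfl)
      · exact Or.inl hv
      all_goals exact Or.inr (hdmem _)
  rw [hS'] at hnew hold hnd ⊢
  have D : IsPendantHexagon G S H H' (c 4) (c 5) (c 0) (c 1) (c 2) (c 3) (d 5) (d 4) (d 3) (d 2) :=
    { hexH := hH
      hexH' := hH'
      vertsH := by
        rw [← hcr]; ext v; simp only [Set.mem_range, Fin.exists_fin_succ, Set.mem_insert_iff,
          Set.mem_singleton_iff]
        grind
      vertsH' := by
        rw [← hdr, ← h0, ← h1]; ext v; simp only [Set.mem_range, Fin.exists_fin_succ,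
          Set.mem_insert_iff, Set.mem_singleton_iff]
        grind
      subset := hHS
      disj := by
        intro v hv
        refine ⟨?_, ?_, ?_, ?_⟩ <;> rintro rfl
        · exact hdS 5 (by decide) (by decide) hv
        · exact hdS 4 (by decide) (by decide) hv
        · exact hdS 3 (by decide) (by decide) hv
        · exact hdS 2 (by decide) (by decide) hv
      nodup := (List.nodup_map_iff hc (l := [4, 5, 0, 1, 2, 3])).2 (by decide)
      nodup' := (List.nodup_map_iff hd (l := [5, 4, 3, 2])).2 (by decide)
      adj_a₀x₀ := (hcadj 4 5).2 (by decide)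
      adj_a₁b₁ := (hcadj 0 1).2 (by decide)
      adj_b₀y₀ := (hcadj 3 2).2 (by decide)
      adj_x₁a₂ := ((hdadj 5 4).2 (by decide)).adj_sub
      adj_b₂y₁ := ((hdadj 3 2).2 (by decide)).adj_sub
      nbr_x₁ := fun z hz h => h0 ▸ hnd 5 (by decide) (by decide) z hz h
      nbr_a₂ := fun z hz h => hnd 4 (by decide) (by decide) z hz h
      nbr_b₂ := fun z hz h => hnd 3 (by decide) (by decide) z hz h
      nbr_y₁ := fun z hz h => h1 ▸ hnd 2 (by decide) (by decide) z hz h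
      nbr_a₁ := fun z hz h => by
        rcases hnew (c 0) (h0 ▸ hdmem 0) z hz h with h | h
        · rw [← h0] at h
          rcases hdn 0 z h with h | h
          · exact Or.inr (Or.inl (h.trans h1))
          · exact Or.inr (Or.inr h)
        · rcases hcn 0 z h with h | h
          · exact Or.inr (Or.inl h)
          · exact Or.inl h
      nbr_b₁ := fun z hz h => by
        rcases hnew (c 1) (h1 ▸ hdmem 1) z hz h with h | h
        · rw [← h1] at h
          rcases hdn 1 z h with h | h
          · exact Or.inr (Or.inr h)
          · exact Or.inr (Or.inl (h.trans h0))
        · rcases hcn 1 z h with h | h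
          · exact Or.inl h
          · exact Or.inr (Or.inl h)
      nbr_x₀ := fun z hz h => (hcn 5 z (hold 5 (Or.inr rfl) z hz h)).symm
      nbr_y₀ := fun z hz h => hcn 2 z (hold 2 (Or.inl rfl) z hz h) }
  exact D.clarSet_eq

end LinearHexagon

/-! ### Building `B'` in stages along the chain. -/

section Chain

variable {V : Type u} {V' : Type v} {B : SimpleGraph V} {B' : SimpleGraph V'}

/-- The copies of the hexagons of `B`, and the hexagons `h 1, …, h j`. -/
def IsStageHexagon (φ : B →g B') (h : ℕ → B'.Subgraph) (j : ℕ) (f : B'.Subgraph) : Prop :=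
  (∃ g : B.Subgraph, IsHexagon g ∧ f = g.map φ) ∨ ∃ i, 1 ≤ i ∧ i ≤ j ∧ f = h i

/-- The vertices of the copy of `B` and of `h 1, …, h j`. -/
def stageVerts (φ : B →g B') (h : ℕ → B'.Subgraph) : ℕ → Set V'
  | 0 => Set.range φ
  | j + 1 => stageVerts φ h j ∪ (h (j + 1)).verts

theorem mem_stageVerts {φ : B →g B'} {h : ℕ → B'.Subgraph} {j : ℕ} {v : V'} :
    v ∈ stageVerts φ h j ↔ v ∈ Set.range φ ∨ ∃ i, 1 ≤ i ∧ i ≤ j ∧ v ∈ (h i).verts := by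
  induction j with
  | zero =>
    refine ⟨Or.inl, ?_⟩
    rintro (hv | ⟨i, h1, h2, -⟩)
    · exact hv
    · omega
  | succ j ih =>
    change v ∈ stageVerts φ h j ∨ v ∈ (h (j + 1)).verts ↔ _
    rw [ih]
    constructor
    · rintro ((hv | ⟨i, h1, h2, hv⟩) | hv)
      · exact Or.inl hv
      · exact Or.inr ⟨i, h1, by omega, hv⟩
      · exact Or.inr ⟨j + 1, by omega, le_rfl, hv⟩
    · rintro (hv | ⟨i, h1, h2, hv⟩)
      · exact Or.inl (Or.inl hv)
      · rcases Nat.lt_or_eq_of_le h2 with h3 | rfl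
        · exact Or.inl (Or.inr ⟨i, h1, by omega, hv⟩)
        · exact Or.inr hv

theorem IsBenzenoid.exists_hexagon_mem [Finite V] (hB : IsBenzenoid B) (x : V) :
    ∃ g : B.Subgraph, IsHexagon g ∧ x ∈ g.verts := by
  have : Nontrivial V := by
    rw [← Finite.one_lt_card_iff_nontrivial]
    have := hB.1.1
    omega
  obtain ⟨y, hy⟩ := hB.1.2.1.preconnected.exists_adj_of_nontrivial x
  obtain ⟨g, hg, hxy⟩ := hB.exists_hexagon_adj hy
  exact ⟨g, hg, g.edge_vert hxy⟩

/-- The combinatorial conditions on the added chain, apart from linearity. -/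
structure IsHexagonChain (φ : B →g B') (h : ℕ → B'.Subgraph) (k : ℕ) : Prop where
  inj : Function.Injective φ
  zero : ∃ h₀ : B.Subgraph, IsHexagon h₀ ∧ h 0 = h₀.map φ
  hex : ∀ i ≤ k, IsHexagon (h i)
  injOn : Set.InjOn h (Set.Iic k)
  new : ∀ i, 1 ≤ i → i ≤ k → ∀ g : B.Subgraph, IsHexagon g → h i ≠ g.map φ
  cover : ((⊤ : B.Subgraph).map φ ⊔ ⨆ i ∈ Set.Icc 1 k, h i) = ⊤
  chain : ∀ i, 1 ≤ i → i ≤ k → ∀ g : B'.Subgraph,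
    HexAdj (h i) g ↔ g = h (i - 1) ∨ (i < k ∧ g = h (i + 1))

namespace IsHexagonChain

variable {φ : B →g B'} {h : ℕ → B'.Subgraph} {k : ℕ}

theorem isHexagon_of_stage (D : IsHexagonChain φ h k) {j : ℕ} (hj : j ≤ k) {f : B'.Subgraph}
    (hf : IsStageHexagon φ h j f) : IsHexagon f := by
  rcases hf with ⟨g, hg, rfl⟩ | ⟨i, -, hi, rfl⟩
  · exact hg.map φ D.inj
  · exact D.hex i (hi.trans hj)

theorem stage_self (D : IsHexagonChain φ h k) {i j : ℕ} (hij : i ≤ j) :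
    IsStageHexagon φ h j (h i) := by
  rcases Nat.eq_zero_or_pos i with rfl | hi
  · obtain ⟨h₀, hh, e⟩ := D.zero
    exact Or.inl ⟨h₀, hh, e⟩
  · exact Or.inr ⟨i, hi, hij, rfl⟩

theorem ne_of_stage (D : IsHexagonChain φ h k) {i j : ℕ} (hj : j < i) (hi : i ≤ k)
    {f : B'.Subgraph} (hf : IsStageHexagon φ h j f) : f ≠ h i := by
  rcases hf with ⟨g, hg, rfl⟩ | ⟨l, h1, hl, rfl⟩
  · exact (D.new i (by omega) hi g hg).symm
  · intro e
    have := D.injOn (show l ≤ k by omega) (show i ≤ k from hi) e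
    omega

/-- A hexagon of stage `j` that meets `h j` is `h j` or `h (j - 1)`. -/
theorem eq_or_eq_of_mem (D : IsHexagonChain φ h k) (hB' : IsBenzenoid B') {j : ℕ}
    (hj : j + 1 ≤ k) {f : B'.Subgraph} (hf : IsStageHexagon φ h (j + 1) f) {v : V'}
    (hv : v ∈ f.verts) (hv' : v ∈ (h (j + 1)).verts) : f = h (j + 1) ∨ f = h j := by
  by_cases hne : h (j + 1) = f
  · exact Or.inl hne.symm
  · right
    have hadj := hB'.hexAdj_of_mem (D.hex _ hj) (D.isHexagon_of_stage hj hf) hne hv' hv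
    rcases (D.chain (j + 1) (by omega) hj f).1 hadj with e | ⟨hlt, e⟩
    · exact e
    · exact absurd e (D.ne_of_stage (by omega) hlt hf)

theorem exists_stage_of_mem [Finite V] (hB : IsBenzenoid B) {j : ℕ} {v : V'}
    (hv : v ∈ stageVerts φ h j) : ∃ f, IsStageHexagon φ h j f ∧ v ∈ f.verts := by
  rcases mem_stageVerts.1 hv with ⟨x, rfl⟩ | ⟨i, h1, h2, hi⟩
  · obtain ⟨g, hg, hx⟩ := hB.exists_hexagon_mem x
    exact ⟨_, Or.inl ⟨g, hg, rfl⟩, x, hx, rfl⟩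
  · exact ⟨_, Or.inr ⟨i, h1, h2, rfl⟩, hi⟩

theorem stage_mono {i j : ℕ} (hij : i ≤ j) {f : B'.Subgraph} (hf : IsStageHexagon φ h i f) :
    IsStageHexagon φ h j f := by
  rcases hf with hf | ⟨l, h1, h2, e⟩
  · exact Or.inl hf
  · exact Or.inr ⟨l, h1, h2.trans hij, e⟩

theorem stageVerts_mono {i j : ℕ} (hij : i ≤ j) : stageVerts φ h i ⊆ stageVerts φ h j := by
  intro v hv
  rw [mem_stageVerts] at hv ⊢
  rcases hv with hv | ⟨l, h1, h2, e⟩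
  · exact Or.inl hv
  · exact Or.inr ⟨l, h1, h2.trans hij, e⟩

/-- The new hexagon `h (j + 1)` meets the earlier vertices only in `h j`. -/
theorem inter_subset [Finite V] (D : IsHexagonChain φ h k) (hB : IsBenzenoid B)
    (hB' : IsBenzenoid B') {j : ℕ} (hj : j + 1 ≤ k) :
    stageVerts φ h j ∩ (h (j + 1)).verts ⊆ (h j).verts := by
  rintro v ⟨hv, hv'⟩
  obtain ⟨f, hf, hvf⟩ := exists_stage_of_mem hB hv
  rcases D.eq_or_eq_of_mem hB' hj (stage_mono (Nat.le_succ j) hf) hvf hv' with e | e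
  · exact absurd e (D.ne_of_stage (by omega) hj hf)
  · exact e ▸ hvf

theorem hexAdj_succ (D : IsHexagonChain φ h k) {j : ℕ} (hj : j + 1 ≤ k) :
    HexAdj (h (j + 1)) (h j) :=
  (D.chain (j + 1) (by omega) hj _).2 (Or.inl rfl)

/-- Descent along the chain: a later hexagon meets earlier stages only in its predecessor, so an
edge with both ends in stage `j` is the edge shared with that predecessor, and passes down. -/
theorem exists_stage_of_chain_adj [Finite V] (D : IsHexagonChain φ h k) (hB : IsBenzenoid B)
    (hB' : IsBenzenoid B') {j : ℕ} {x y : V'} (hx : x ∈ stageVerts φ h j)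
    (hy : y ∈ stageVerts φ h j) (i : ℕ) (hi : i ≤ k) (hxy : (h i).Adj x y) :
    ∃ f, IsStageHexagon φ h j f ∧ f.Adj x y := by
  induction i with
  | zero => exact ⟨_, D.stage_self (Nat.zero_le j), hxy⟩
  | succ i ih =>
    by_cases hij : i + 1 ≤ j
    · exact ⟨_, D.stage_self hij, hxy⟩
    · refine ih (by omega) ?_
      have hsub := stageVerts_mono (φ := φ) (h := h) (show j ≤ i by omega)
      have hx' := D.inter_subset hB hB' hi ⟨hsub hx, (h (i + 1)).edge_vert hxy⟩
      have hy' := D.inter_subset hB hB' hi ⟨hsub hy, (h (i + 1)).edge_vert hxy.symm⟩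
      obtain ⟨p, q, -, hpq, hv⟩ := (D.hexAdj_succ hi).exists_common_edge hB'
      have hx2 : x ∈ (h (i + 1)).verts ∩ (h i).verts := ⟨(h (i + 1)).edge_vert hxy, hx'⟩
      have hy2 : y ∈ (h (i + 1)).verts ∩ (h i).verts := ⟨(h (i + 1)).edge_vert hxy.symm, hy'⟩
      have hne := hxy.adj_sub.ne
      rw [hv] at hx2 hy2
      rcases hx2 with rfl | rfl <;> rcases hy2 with rfl | rfl
      · exact absurd rfl hne
      · exact hpq
      · exact hpq.symm
      · exact absurd rfl hne

/-- Every edge between vertices of stage `j` lies in a hexagon of stage `j`. -/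
theorem exists_stage_adj [Finite V] (D : IsHexagonChain φ h k) (hB : IsBenzenoid B)
    (hB' : IsBenzenoid B') {j : ℕ} {x y : V'} (hx : x ∈ stageVerts φ h j)
    (hy : y ∈ stageVerts φ h j) (hxy : B'.Adj x y) :
    ∃ f, IsStageHexagon φ h j f ∧ f.Adj x y := by
  have hT : (⊤ : B'.Subgraph).Adj x y := hxy
  rw [← D.cover, Subgraph.sup_adj] at hT
  rcases hT with ⟨a, b, hab, rfl, rfl⟩ | hT
  · obtain ⟨g, hg, hgab⟩ := hB.exists_hexagon_adj hab.adj_sub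
    exact ⟨_, Or.inl ⟨g, hg, rfl⟩, a, b, hgab, rfl, rfl⟩
  · simp only [Subgraph.iSup_adj] at hT
    obtain ⟨i, hi, hT⟩ := hT
    exact D.exists_stage_of_chain_adj hB hB' hx hy i hi.2 hT

theorem stageVerts_eq_univ (D : IsHexagonChain φ h k) : stageVerts φ h k = Set.univ := by
  refine Set.eq_univ_of_forall fun v => ?_
  have hT : v ∈ (⊤ : B'.Subgraph).verts := trivial
  rw [← D.cover, Subgraph.verts_sup] at hT
  rw [mem_stageVerts]
  rcases hT with ⟨a, -, rfl⟩ | hT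
  · exact Or.inl ⟨a, rfl⟩
  · simp only [Subgraph.verts_iSup, Set.mem_iUnion] at hT
    obtain ⟨i, hi, hT⟩ := hT
    exact Or.inr ⟨i, hi.1, hi.2, hT⟩

/-- Stage 0 of the descent: the chain adds no chord to the copy of `B`, as needed to carry hexagons
and matchings back. -/
theorem adj_of_map_adj [Finite V] (D : IsHexagonChain φ h k) (hB : IsBenzenoid B)
    (hB' : IsBenzenoid B') (x y : V) (hxy : B'.Adj (φ x) (φ y)) : B.Adj x y := by
  obtain ⟨f, hf, hfxy⟩ := D.exists_stage_adj hB hB' (j := 0) ⟨x, rfl⟩ ⟨y, rfl⟩ hxy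
  rcases hf with ⟨g, -, rfl⟩ | ⟨i, h1, h2, -⟩
  · obtain ⟨a, b, hab, ha, hb⟩ := hfxy
    rw [← D.inj ha, ← D.inj hb]
    exact hab.adj_sub
  · omega

/-- Adding the next hexagon of the chain does not change the Clar set. -/
theorem clarSet_stage_succ [Finite V] [Finite V'] (D : IsHexagonChain φ h k) (hB : IsBenzenoid B)
    (hB' : IsBenzenoid B') {j : ℕ} (hj : j + 1 ≤ k)
    (hlin : IsLinear (h j) ∨ ∀ g : B'.Subgraph, HexAdj (h j) g ↔ g = h (j + 1)) :
    clarSet B' (stageVerts φ h (j + 1)) = clarSet B' (stageVerts φ h j) := by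
  have hsucc := D.hexAdj_succ hj
  obtain ⟨p, q, hpq', hpq, hv⟩ := hsucc.exists_common_edge hB'
  rw [Set.inter_comm] at hv
  have hH := D.hex j (by omega)
  have hH' := D.hex (j + 1) hj
  obtain ⟨c, hc, hcr, hcadj, rfl, rfl⟩ := hH.exists_labelling hpq
  obtain ⟨d, hd, hdr, hdadj, h0, h1⟩ := hH'.exists_labelling hpq'
  have hcmem : ∀ i, c i ∈ (h j).verts := fun i => hcr ▸ ⟨i, rfl⟩
  have hHS : (h j).verts ⊆ stageVerts φ h j := by
    intro v hv
    rw [mem_stageVerts]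
    rcases D.stage_self (le_refl j) with ⟨g, -, e⟩ | ⟨i, h1, h2, e⟩
    · rw [e] at hv
      obtain ⟨x, -, rfl⟩ := hv
      exact Or.inl ⟨x, rfl⟩
    · exact Or.inr ⟨i, h1, h2, e ▸ hv⟩
  refine clarSet_union_hexagon hH hH' hc hcr hcadj hd hdr hdadj h0 h1 hv hHS
    (D.inter_subset hB hB' hj) ?_ ?_
  · intro x hx z hz hxz
    obtain ⟨f, hf, hfxz⟩ := D.exists_stage_adj hB hB' (j := j + 1) (Or.inr hx) hz hxz
    rcases D.eq_or_eq_of_mem hB' hj hf (f.edge_vert hfxz) hx with rfl | rfl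
    · exact Or.inl hfxz
    · exact Or.inr hfxz
  · intro t ht z hz htz
    have hsymm : HexAdj (h j) (h (j + 1)) :=
      ⟨hH, hH', hsucc.2.2.1.symm, by rw [Set.inter_comm]; exact hsucc.2.2.2⟩
    rcases hlin with hl | hl
    · exact hl.adj_of_adj hB' hsymm hc hcr hcadj hv t ht z htz
    · obtain ⟨f, hf, hfz⟩ := hB'.exists_hexagon_adj htz
      by_cases hne : h j = f
      · rwa [hne]
      -- The only neighbouring hexagon meets `h j` in `c 0` and `c 1`, so no other hexagon passes
      -- through `c 2` or `c 5`.
      · have e := (hl f).1 (hB'.hexAdj_of_mem hH hf hne (hcmem t) (f.edge_vert hfz))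
        have hmem : c t ∈ (h j).verts ∩ (h (j + 1)).verts := ⟨hcmem t, e ▸ f.edge_vert hfz⟩
        rw [hv] at hmem
        exfalso
        rcases hmem with h' | h' <;> have := hc h' <;> rcases ht with rfl | rfl <;> simp at this

end IsHexagonChain

end Chain

end Benzenoid

theorem mainTheorem5 {V : Type*} {V' : Type*} [Finite V] [Finite V']
    (B : SimpleGraph V) (B' : SimpleGraph V')
    (hB : Benzenoid.IsCatacondensed B) (hB' : Benzenoid.IsBenzenoid B')
    (h₀ : B.Subgraph) (hh₀ : Benzenoid.IsHexagon h₀)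
    (hadj : {g : B.Subgraph | Benzenoid.HexAdj h₀ g}.Subsingleton)
    (k : ℕ) (hk : 1 ≤ k) (φ : B →g B')
    (hext : Benzenoid.IsLinearExtension φ h₀ k) :
    Benzenoid.clarNumber B' = Benzenoid.clarNumber B := by
  obtain ⟨hφ, h, hzero, hhex, hinj, hnew, hcover, hchain, hlin, hlin0⟩ := hext
  have D : Benzenoid.IsHexagonChain φ h k :=
    ⟨hφ, ⟨h₀, hh₀, hzero⟩, hhex, hinj, hnew, hcover, hchain⟩
  have hstage : ∀ j ≤ k, Benzenoid.clarSet B' (Benzenoid.stageVerts φ h j) =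
      Benzenoid.clarSet B' (Set.range φ) := by
    intro j
    induction j with
    | zero => intro _; rfl
    | succ j ih =>
      intro hj
      -- The hexagon receiving the new one is `h j`: for `j = 0` it may be terminal instead of
      -- linear, and for `0 < j < k` it is linear.
      rw [D.clarSet_stage_succ hB.1 hB' hj ?_, ih (by omega)]
      rcases Nat.eq_zero_or_pos j with rfl | hpos
      · exact hlin0
      · exact Or.inl (hlin j hpos (by omega))
  rw [Benzenoid.clarNumber_eq_sSup_clarSet, Benzenoid.clarNumber_eq_sSup_clarSet,
    Benzenoid.clarSet_univ_eq_clarSet_range φ hφ (D.adj_of_map_adj hB.1 hB'),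
    ← D.stageVerts_eq_univ, hstage k le_rfl]
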